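/- Let $\mathcal G$ be an undirected weighted graph with $n$ vertices, given by a symmetric weighted adjacency matrix $W_{\mathcal G}\in\mathbb R^{n\times n}$ with nonnegative entries and positive degrees; let $D$ be the diagonal degree matrix, $L=I-D^{-1/2}W_{\mathcal G}D^{-1/2}$ the normalized Laplacian, and $L=U\Sigma U^\top$ an eigendecomposition with $U=(\mathbf u_1,\dots,\mathbf u_n)$ orthogonal and $\Sigma=\mathrm{diag}(\sigma_1,\dots,\sigma_n)$, $\sigma_1\le\dots\le\sigma_n$. Let $\Delta t>0$, $A=\exp(-\Delta t L)$, $\lambda_i=\exp(-\Delta t\,\sigma_i)$, $1\le k\le n$, $T\ge 1$, $U_k=(\mathbf u_1,\dots,\mathbf u_k)$, $f_T(\lambda)=\big(\sum_{t=0}^{T-1}\lambda^{2t}\big)^{1/2}$ and $\pi_{A,T}(\mathbf x)=(\mathbf x,A\mathbf x,\dots,A^{T-1}\mathbf x)\in\mathbb R^{Tn}$, whose coordinates are indexed by the space-time nodes $(t,i)$, $0\le t<T$, $1\le i\le n$. Let $\widetilde U\in\mathbb R^{Tn\times k}$ be the matrix with entries $\widetilde U((t,i),\ell)=\lambda_\ell^{t}\,U(i,\ell)/f_T(\lambda_\ell)$.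 Consider one of three sampling regimes; all the probability distributions are entrywise positive, and all draws are independent (with replacement). 1. $\mathbf p$ is a distribution on $\{1,\dots,n\}$, and $\omega_1,\dots,\omega_m$ are drawn from $\mathbf p$. The sampled nodes are $(t,\omega_i)$ for $0\le t<T$, $1\le i\le m$, so the number of samples is $M=Tm$; the sample $(t,\omega_i)$ has probability $\mathbf p(\omega_i)$ and weight $1/m$. Put $\nu=\max_i \mathbf p(i)^{-1/2}\,\big\|(\widetilde U((t,i),\ell))_{0\le t<T,\,1\le \ell\le k}\big\|_2$ (operator norm). 2. For each $0\le t<T$, $\mathbf p_t$ is a distribution on $\{1,\dots,n\}$, and $\omega_{t,1},\dots,\omega_{t,m_t}$ are drawn from $\mathbf p_t$. The sampled nodes are $(t,\omega_{t,i})$, $M=\sum_t m_t$; the sample $(t,\omega_{t,i})$ has probability $\mathbf p_t(\omega_{t,i})$ and weight $1/m_t$. Put $\nu(t)=\max_i \mathbf p_t(i)^{-1/2}\,\|\widetilde U((t,i),\cdot)\|_2$. 3. $\mathbf p$ is a distribution on the space-time nodes, and the sampled nodes $\omega_1,\dots,\omega_m$ are drawn from $\mathbf p$, $M=m$; the sample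 $\omega_i$ has probability $\mathbf p(\omega_i)$ and weight $1/m$. Put $\nu=\max_{(t,i)} \mathbf p(t,i)^{-1/2}\,\|\widetilde U((t,i),\cdot)\|_2$. Let $S\in\{0,1\}^{M\times Tn}$ be the matrix that reads off the coordinates at the sampled nodes, and let $P$ and $W$ be the $M\times M$ diagonal matrices of the probabilities and of the weights of the samples. Let $\varepsilon,\delta\in(0,1)$ and suppose that $m\ge \frac{3}{\delta^2}\nu^2\log\frac{2k}{\varepsilon}$ in regimes 1 and 3, and $m_t\ge\frac{3}{\delta^2}\nu(t)^2\log\frac{2k}{\varepsilon}$ for all $0\le t<T$ in regime 2. Then, in each regime, with probability at least $1-\varepsilon$ the following holds for all $\mathbf x\in\mathrm{span}(U_k)$. (i) For all $\mathbf e\in\mathbb R^M$, the problem of minimizing $\|P^{-1/2}W^{1/2}(S\pi_{A,T}(\widetilde{\mathbf x})-\mathbf y)\|_2$ over $\widetilde{\mathbf x}\in\mathrm{span}(U_k)$ with $\mathbf y=S\pi_{A,T}(\mathbf x)+\mathbf e$ has a unique solution $\mathbf x^*$, and $$\|\mathbf x^*-\mathbf x\|_2\le\frac{2}{\sqrt{1-\delta}\,f_T(\lambda_k)}\,\|P^{-1/2}W^{1/2}\mathbf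 e\|_2 .$$ (ii) There is a nonzero $\mathbf e_0\in\mathbb R^M$ such that the solution $\mathbf x^*$ of the same problem with $\mathbf y=S\pi_{A,T}(\mathbf x)+\mathbf e_0$ satisfies $$\|\mathbf x^*-\mathbf x\|_2\ge\frac{1}{\sqrt{1+\delta}\,f_T(\lambda_1)}\,\|P^{-1/2}W^{1/2}\mathbf e_0\|_2 .$$ -/

import Mathlib

open MeasureTheory ProbabilityTheory
open scoped Matrix

namespace DynSampling

noncomputable section

/-- An undirected weighted graph on the vertices `0, …, n-1`, given by its symmetric weighted
adjacency matrix with nonnegative entries; the edges are the pairs with nonzero weight. -/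
structure WeightedGraph (n : ℕ) where
  weight : Matrix (Fin n) (Fin n) ℝ
  symm : weight.IsSymm
  nonneg : ∀ i j, 0 ≤ weight i j

namespace WeightedGraph

variable {n : ℕ} (G : WeightedGraph n)

/-- The degree of a vertex: the sum of the weights of its edges. -/
def deg (i : Fin n) : ℝ := ∑ j, G.weight i j

/-- The matrix `D^{-1/2}`, where `D` is the diagonal matrix of (positive) degrees. -/
def invSqrtDeg : Matrix (Fin n) (Fin n) ℝ := Matrix.diagonal fun i => (√(G.deg i))⁻¹

/-- The normalized diffusion operator `N = D^{-1/2} W D^{-1/2}`. -/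
def diffusion : Matrix (Fin n) (Fin n) ℝ := G.invSqrtDeg * G.weight * G.invSqrtDeg

/-- The normalized graph Laplacian `L = I - N`. -/
def laplacian : Matrix (Fin n) (Fin n) ℝ := 1 - G.diffusion

/-- The evolution operator `A = exp(-Δt L)` of the heat diffusion over one time step. -/
def evolution (Δt : ℝ) : Matrix (Fin n) (Fin n) ℝ := NormedSpace.exp (-Δt • G.laplacian)

end WeightedGraph

/-- `L = U diag(σ) Uᵀ` with orthonormal columns of `U` and eigenvalues in increasing order. -/
structure IsEigenDecomposition {n : ℕ} (L U : Matrix (Fin n) (Fin n) ℝ) (σ : Fin n → ℝ) :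
    Prop where
  orthogonal : U ∈ Matrix.orthogonalGroup (Fin n) ℝ
  monotone : Monotone σ
  decomp : L = U * Matrix.diagonal σ * Uᵀ

/-- The eigenvalues `λ_i = exp(-Δt σ_i)` of the evolution operator. -/
def evolEigenvalue {n : ℕ} (Δt : ℝ) (σ : Fin n → ℝ) (i : Fin n) : ℝ := Real.exp (-Δt * σ i)

/-- The matrix `U_k` of the first `k` columns of `U`. -/
def firstCols {n k : ℕ} (hkn : k ≤ n) (U : Matrix (Fin n) (Fin n) ℝ) :
    Matrix (Fin n) (Fin k) ℝ :=
  U.submatrix id (Fin.castLE hkn)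

/-- The space `span(U_k)` of `k`-bandlimited signals. -/
def bandlimited {n k : ℕ} (hkn : k ≤ n) (U : Matrix (Fin n) (Fin n) ℝ) :
    Submodule ℝ (Fin n → ℝ) :=
  Submodule.span ℝ (Set.range (firstCols hkn U).col)

/-- `f_T(λ) = (∑_{t=0}^{T-1} λ^{2t})^{1/2}`. -/
def fT (T : ℕ) (l : ℝ) : ℝ := √(∑ t ∈ Finset.range T, l ^ (2 * t))

/-- The Euclidean norm of a finite real vector. -/
def l2norm {ι : Type*} [Fintype ι] (v : ι → ℝ) : ℝ := ‖WithLp.toLp 2 v‖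

open scoped Matrix.Norms.L2Operator in
/-- The operator norm of a real matrix with respect to the Euclidean norms. -/
def opNorm {ι κ : Type*} [Fintype ι] [Fintype κ] [DecidableEq κ] (B : Matrix ι κ ℝ) : ℝ := ‖B‖

/-- The space-time field `π_{A,T}(x) = (x, A x, …, A^{T-1} x)`. The space-time node `i + tn` is
represented by the pair `(t, i)`. -/
def diffusionField {n : ℕ} (A : Matrix (Fin n) (Fin n) ℝ) (T : ℕ) (x : Fin n → ℝ) :
    Fin T × Fin n → ℝ :=
  fun q => ((A ^ (q.1 : ℕ)) *ᵥ x) q.2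

/-- The matrix `Ũ_{k,T}` whose column `ℓ` is the stack of `(λ_ℓ^t / f_T(λ_ℓ)) u_ℓ`,
`t = 0, …, T-1`. -/
def spaceTimeBasis {n k : ℕ} (hkn : k ≤ n) (T : ℕ) (Δt : ℝ) (U : Matrix (Fin n) (Fin n) ℝ)
    (σ : Fin n → ℝ) : Matrix (Fin T × Fin n) (Fin k) ℝ :=
  Matrix.of fun q l =>
    evolEigenvalue Δt σ (Fin.castLE hkn l) ^ (q.1 : ℕ) /
      fT T (evolEigenvalue Δt σ (Fin.castLE hkn l)) * firstCols hkn U q.2 l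

/-- A non-degenerate probability distribution on a finite set. -/
structure IsPosDistribution {ι : Type*} [Fintype ι] (p : ι → ℝ) : Prop where
  pos : ∀ i, 0 < p i
  sum_eq_one : ∑ i, p i = 1

/-- The spectral graph weighted coherence for random spatial locations at the initial time:
the maximum over the vertices `i` of the operator norm of the rows `(t, i)`, `t = 0, …, T-1`,
divided by the square root of `p i`. -/
def coherence₁ {n k T : ℕ} (V : Matrix (Fin T × Fin n) (Fin k) ℝ) (p : Fin n → ℝ) : ℝ :=
  ⨆ i : Fin n, 1 / √(p i) * opNorm (V.submatrix (fun t : Fin T => (t, i)) id)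

/-- The spectral graph weighted coherence at time `t` for random spatial locations at
consecutive times. -/
def coherence₂ {n k T : ℕ} (V : Matrix (Fin T × Fin n) (Fin k) ℝ) (p : Fin T → Fin n → ℝ)
    (t : Fin T) : ℝ :=
  ⨆ i : Fin n, 1 / √(p t i) * l2norm (Vᵀ *ᵥ Pi.single (t, i) 1)

/-- The spectral graph weighted coherence for random space-time locations. -/
def coherence₃ {n k T : ℕ} (V : Matrix (Fin T × Fin n) (Fin k) ℝ) (p : Fin T × Fin n → ℝ) : ℝ :=
  ⨆ q : Fin T × Fin n, 1 / √(p q) * l2norm (Vᵀ *ᵥ Pi.single q 1)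

/-- The random variables `ω j` are independent and `ω j` has the law `p j`:
`ℙ(ω j = i) = p j i`. -/
structure IsIndependentDraw {Ω ι κ : Type*} [MeasurableSpace Ω] [MeasurableSpace κ]
    (μ : Measure Ω) (p : ι → κ → ℝ) (ω : ι → Ω → κ) : Prop where
  measurable : ∀ j, Measurable (ω j)
  indep : iIndepFun ω μ
  law : ∀ j i, μ.real (ω j ⁻¹' {i}) = p j i

/-- The 0-1 sampling matrix whose row `r` has its single one in the column `loc r`. -/
def samplingMatrix {M N : Type*} [DecidableEq N] (loc : M → N) : Matrix M N ℝ :=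
  Matrix.of fun r c => if c = loc r then 1 else 0

/-- The sampling matrix `S₁ = diag(S₁⁽⁰⁾; …; S₁⁽⁰⁾)`: the vertices `ω i` are sampled at all
times. -/
def samplingMatrix₁ {n m : ℕ} (T : ℕ) (ω : Fin m → Fin n) :
    Matrix (Fin T × Fin m) (Fin T × Fin n) ℝ :=
  samplingMatrix fun r => (r.1, ω r.2)

/-- The sampling matrix `S₂ = diag(S₂⁽⁰⁾; …; S₂⁽ᵀ⁻¹⁾)`: the vertices `ω ⟨t, i⟩`, `i < m t`, are
sampled at the time `t`. -/
def samplingMatrix₂ {n T : ℕ} {m : Fin T → ℕ} (ω : (Σ t, Fin (m t)) → Fin n) :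
    Matrix (Σ t, Fin (m t)) (Fin T × Fin n) ℝ :=
  samplingMatrix fun r => (r.1, ω r)

/-- The sampling matrix `S₃`: the space-time nodes `ω i` are sampled. -/
def samplingMatrix₃ {n T m : ℕ} (ω : Fin m → Fin T × Fin n) :
    Matrix (Fin m) (Fin T × Fin n) ℝ :=
  samplingMatrix ω

/-- The probability matrix on the sampling set: the diagonal part of `S P Sᵀ`, where `P` is the
diagonal matrix of the probabilities `p`. -/
def sampledProb {M N : Type*} [DecidableEq M] [Fintype N] [DecidableEq N]
    (S : Matrix M N ℝ) (p : N → ℝ) : Matrix M M ℝ :=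
  Matrix.diagonal (S * Matrix.diagonal p * Sᵀ).diag

/-- The weighting matrix `W₁ = (1/m) I`. -/
def weighting₁ (T m : ℕ) : Matrix (Fin T × Fin m) (Fin T × Fin m) ℝ :=
  Matrix.diagonal fun _ => 1 / (m : ℝ)

/-- The weighting matrix `W₂ = diag((1/m₀) I; …; (1/m_{T-1}) I)`. -/
def weighting₂ {T : ℕ} (m : Fin T → ℕ) : Matrix (Σ t, Fin (m t)) (Σ t, Fin (m t)) ℝ :=
  Matrix.diagonal fun r => 1 / (m r.1 : ℝ)

/-- The weighting matrix `W₃ = (1/m) I`. -/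
def weighting₃ (m : ℕ) : Matrix (Fin m) (Fin m) ℝ :=
  Matrix.diagonal fun _ => 1 / (m : ℝ)

/-- The vector `P^{-1/2} W^{1/2} v` for diagonal matrices `P`, `W` with positive diagonals. -/
def reweight {M : Type*} [Fintype M] [DecidableEq M] (P W : Matrix M M ℝ) (v : M → ℝ) : M → ℝ :=
  (Matrix.diagonal (fun r => (√(P r r))⁻¹) * Matrix.diagonal (fun r => √(W r r))) *ᵥ v

/-- `x'` solves the weighted least-squares problem: it minimizes
`‖P^{-1/2} W^{1/2} (S π_{A,T}(z) - y)‖₂` over `z ∈ E`. -/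
def IsLeastSquares {n T : ℕ} {M : Type*} [Fintype M] [DecidableEq M]
    (E : Submodule ℝ (Fin n → ℝ)) (A : Matrix (Fin n) (Fin n) ℝ)
    (S : Matrix M (Fin T × Fin n) ℝ) (P W : Matrix M M ℝ) (y : M → ℝ) (x' : Fin n → ℝ) : Prop :=
  x' ∈ E ∧ ∀ z ∈ E, l2norm (reweight P W (S *ᵥ diffusionField A T x' - y)) ≤
    l2norm (reweight P W (S *ᵥ diffusionField A T z - y))

/-- For every signal `x ∈ E`: for all noise `e`, the least-squares problem with data
`y = S π_{A,T}(x) + e` has exactly one solution, and its error is at most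
`Cup ‖P^{-1/2} W^{1/2} e‖₂`; and for some nonzero noise `e₀` the error of the solution is at
least `Clow ‖P^{-1/2} W^{1/2} e₀‖₂`. -/
def ErrorBounds {n T : ℕ} {M : Type*} [Fintype M] [DecidableEq M]
    (E : Submodule ℝ (Fin n → ℝ)) (A : Matrix (Fin n) (Fin n) ℝ)
    (S : Matrix M (Fin T × Fin n) ℝ) (P W : Matrix M M ℝ) (Cup Clow : ℝ) : Prop :=
  ∀ x ∈ E,
    (∀ e : M → ℝ,
      (∃! x' : Fin n → ℝ, IsLeastSquares E A S P W (S *ᵥ diffusionField A T x + e) x') ∧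
      ∀ x' : Fin n → ℝ, IsLeastSquares E A S P W (S *ᵥ diffusionField A T x + e) x' →
        l2norm (x' - x) ≤ Cup * l2norm (reweight P W e)) ∧
    (∃ e₀ : M → ℝ, e₀ ≠ 0 ∧
      ∀ x' : Fin n → ℝ, IsLeastSquares E A S P W (S *ᵥ diffusionField A T x + e₀) x' →
        Clow * l2norm (reweight P W e₀) ≤ l2norm (x' - x))

end

end DynSampling

/-!
The measurement operator of a sampling pattern is nearly isometric on `k`-bandlimited signals with
high probability. Indeed the rows of `Ũ_{k,T}` have the identity as the sum of their Gram
matrices, so the reweighted Gram matrix of the sampled rows is a sum of independent positive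
semidefinite matrices with mean the identity, each bounded in terms of the coherence; by the matrix
Chernoff inequality it lies between `1 - δ` and `1 + δ`. The Chernoff inequality follows from
Lieb's theorem that `X ↦ tr exp (H + log X)` is concave: by the Gibbs variational principle this
function is a partial supremum of a jointly concave function, the relative entropy being jointly
convex because it is an integral of quadratic divergences, each of them a supremum of linear
functionals.

Given the near isometry, least squares recovers `x` up to twice the norm of the noise over the
lower isometry constant. The lower bound comes from noise that is itself the measurement of a
bandlimited signal, which no estimator can tell from a change of `x`.
-/

namespace DynSampling

open scoped MatrixOrder

section Spectral
variable {ι : Type*} [Fintype ι] [DecidableEq ι]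

/-- The symmetric matrices with a fixed orthonormal eigenbasis, the columns of `V`, as the image
of the star algebra of their eigenvalues. -/
noncomputable def spectral (V : Matrix.orthogonalGroup ι ℝ) : (ι → ℝ) →⋆ₐ[ℝ] Matrix ι ι ℝ :=
  (Unitary.conjStarAlgAut ℝ (Matrix ι ι ℝ) V : Matrix ι ι ℝ →⋆ₐ[ℝ] Matrix ι ι ℝ).comp
    { Matrix.diagonalAlgHom ℝ with
      map_star' := fun a => (Matrix.diagonal_conjTranspose a).symm }

variable (V W : Matrix.orthogonalGroup ι ℝ) (a b : ι → ℝ)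

lemma spectral_apply : spectral V a = V.1 * Matrix.diagonal a * V.1ᵀ := rfl

lemma isHermitian_spectral : (spectral V a).IsHermitian :=
  (IsSelfAdjoint.all a).map (spectral V)

lemma exists_eq_spectral {A : Matrix ι ι ℝ} (hA : A.IsHermitian) : ∃ V a, A = spectral V a :=
  ⟨hA.eigenvectorUnitary, hA.eigenvalues, hA.spectral_theorem⟩

variable {a b} in
lemma spectral_le_spectral_iff : spectral V a ≤ spectral V b ↔ a ≤ b := by
  rw [Matrix.le_iff, ← map_sub, ← sub_nonneg]
  exact (Matrix.IsUnit.posSemidef_star_right_conjugate_iff Unitary.isUnit_coe).trans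
    Matrix.posSemidef_diagonal_iff

variable {a} in
lemma posDef_spectral_iff : (spectral V a).PosDef ↔ ∀ i, 0 < a i :=
  (Matrix.IsUnit.posDef_star_right_conjugate_iff Unitary.isUnit_coe).trans
    Matrix.posDef_diagonal_iff

lemma cfc_spectral (f : ℝ → ℝ) : cfc f (spectral V a) = spectral V (f ∘ a) := by
  classical
  let q : Polynomial ℝ := Lagrange.interpolate (Finset.univ.image a) id f
  have hq (i : ι) : q.eval (a i) = f (a i) :=
    Lagrange.eval_interpolate_at_node f Function.injective_id.injOn
      (Finset.mem_image_of_mem a (Finset.mem_univ i))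
  have hspec : spectrum ℝ (spectral V a) ⊆ Set.range a := by
    refine (AlgHom.spectrum_apply_subset (spectral V) a).trans ?_
    rw [Pi.spectrum_eq]
    refine Set.iUnion_subset fun i x hx => ⟨i, ?_⟩
    simpa [spectrum.mem_iff, sub_eq_zero, eq_comm] using hx
  calc cfc f (spectral V a) = cfc q.eval (spectral V a) := by
        refine cfc_congr fun x hx => ?_
        obtain ⟨i, rfl⟩ := hspec hx
        exact (hq i).symm
    _ = Polynomial.aeval (spectral V a) q := cfc_polynomial q _ (isHermitian_spectral V a)
    _ = spectral V (Polynomial.aeval a q) := Polynomial.aeval_algHom_apply (spectral V) a q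
    _ = spectral V (f ∘ a) := by
        congr 1
        ext i
        refine Eq.trans ?_ (hq i)
        simp

lemma exp_spectral : NormedSpace.exp (spectral V a) = spectral V (Real.exp ∘ a) := by
  open scoped Matrix.Norms.L2Operator in
  exact (CFC.real_exp_eq_normedSpace_exp (isHermitian_spectral V a)).symm.trans
    (cfc_spectral V a Real.exp)

lemma trace_spectral : (spectral V a).trace = ∑ i, a i := by
  have hV : V.1ᵀ * V.1 = 1 := (Matrix.mem_orthogonalGroup_iff' ι ℝ).1 V.2
  rw [spectral_apply, Matrix.trace_mul_cycle, hV, one_mul, Matrix.trace_diagonal]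

lemma trace_conj_mul_conj_transpose (X Y : Matrix ι ι ℝ) :
    ((V.1 * X * W.1ᵀ) * (V.1 * Y * W.1ᵀ)ᵀ).trace = ∑ i, ∑ j, X i j * Y i j := by
  have hV : V.1ᵀ * V.1 = 1 := (Matrix.mem_orthogonalGroup_iff' ι ℝ).1 V.2
  have hW : W.1ᵀ * W.1 = 1 := (Matrix.mem_orthogonalGroup_iff' ι ℝ).1 W.2
  calc ((V.1 * X * W.1ᵀ) * (V.1 * Y * W.1ᵀ)ᵀ).trace
      = ((V.1 * (X * (W.1ᵀ * W.1))) * (Yᵀ * V.1ᵀ)).trace := by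
        simp only [Matrix.transpose_mul, Matrix.transpose_transpose, Matrix.mul_assoc]
    _ = (X * Yᵀ * (V.1ᵀ * V.1)).trace := by
        rw [hW, mul_one, Matrix.mul_assoc, Matrix.trace_mul_comm]
        simp only [Matrix.mul_assoc]
    _ = ∑ i, ∑ j, X i j * Y i j := by
        rw [hV, mul_one, ← Matrix.sum_hadamard_eq]; rfl

lemma spectral_eq_conj_left :
    spectral V a = V.1 * (Matrix.diagonal a * (V.1ᵀ * W.1)) * W.1ᵀ := by
  have hW : W.1 * W.1ᵀ = 1 := (Matrix.mem_orthogonalGroup_iff ι ℝ).1 W.2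
  simp only [spectral_apply, Matrix.mul_assoc, hW, mul_one]

lemma spectral_eq_conj_right :
    spectral W b = V.1 * (V.1ᵀ * W.1 * Matrix.diagonal b) * W.1ᵀ := by
  have hV : V.1 * V.1ᵀ = 1 := (Matrix.mem_orthogonalGroup_iff ι ℝ).1 V.2
  simp only [spectral_apply, ← Matrix.mul_assoc, hV, one_mul]

lemma trace_spectral_mul_spectral : (spectral V a * spectral W b).trace =
    ∑ i, ∑ j, (V.1ᵀ * W.1) i j ^ 2 * (a i * b j) := by
  have hsymm : spectral W b = (spectral W b)ᵀ := (isHermitian_spectral W b).symm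
  rw [hsymm, spectral_eq_conj_left V W a, spectral_eq_conj_right V W b,
    trace_conj_mul_conj_transpose]
  refine Finset.sum_congr rfl fun i _ => Finset.sum_congr rfl fun j _ => ?_
  rw [Matrix.diagonal_mul, Matrix.mul_diagonal]
  ring

end Spectral

section RelativeEntropy

open InformationTheory (klFun)

variable {ι : Type*}

lemma convex_setOf_posDef : Convex ℝ {A : Matrix ι ι ℝ | A.PosDef} :=
  convex_iff_forall_pos.2 fun _ hA _ hB _ _ hs ht _ => (hA.smul hs).add (hB.smul ht)

variable [Fintype ι]

/-- For fixed `u` and `Z` this functional is linear in `(A, B)`; maximizing it over `Z` gives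
`chiSqDiv u A B`. -/
def chiSqFunctional (u : ℝ) (A B Z : Matrix ι ι ℝ) : ℝ :=
  (((2 : ℝ) • (A - B) - ((1 - u) • (A * Z) + u • (Z * B))) * Zᵀ).trace

/-- The `χ²`-divergence of `A` and `B` whose weight is the interpolation of the left multiplication
by `A` and the right multiplication by `B`: the quadratic form of the inverse of
`Z ↦ (1 - u) A Z + u Z B` at `A - B`, written in variational form. -/
noncomputable def chiSqDiv (u : ℝ) (A B : Matrix ι ι ℝ) : ℝ :=
  ⨆ Z, chiSqFunctional u A B Z

lemma chiSqFunctional_add_smul (u s t : ℝ) (A B A' B' Z : Matrix ι ι ℝ) :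
    chiSqFunctional u (s • A + t • A') (s • B + t • B') Z =
      s * chiSqFunctional u A B Z + t * chiSqFunctional u A' B' Z := by
  simp only [chiSqFunctional, Matrix.sub_mul, Matrix.add_mul, Matrix.mul_add, Matrix.smul_mul,
    Matrix.mul_smul, Matrix.trace_sub, Matrix.trace_add, Matrix.trace_smul, smul_eq_mul]
  ring

section Eigenbasis

variable [DecidableEq ι]

/-- The Umegaki relative entropy `tr (A (log A - log B) - A + B)` of positive definite matrices;
the last two terms make it nonnegative without any normalization of the traces. -/
noncomputable def relEntropy (A B : Matrix ι ι ℝ) : ℝ :=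
  (A * (cfc Real.log A - cfc Real.log B)).trace - A.trace + B.trace

lemma relEntropy_spectral (V W : Matrix.orthogonalGroup ι ℝ) {a b : ι → ℝ} (ha : ∀ i, 0 < a i)
    (hb : ∀ i, 0 < b i) : relEntropy (spectral V a) (spectral W b) =
      ∑ i, ∑ j, (V.1ᵀ * W.1) i j ^ 2 * (b j * klFun (a i / b j)) := by
  have hlog : (spectral V a * spectral V (Real.log ∘ a)).trace =
      (spectral V (a * (Real.log ∘ a)) * spectral W 1).trace := by
    rw [map_mul, map_one, mul_one]
  have htrA : (spectral V a).trace = (spectral V a * spectral W 1).trace := by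
    rw [map_one, mul_one]
  have htrB : (spectral W b).trace = (spectral V 1 * spectral W b).trace := by
    rw [map_one, one_mul]
  rw [relEntropy, cfc_spectral, cfc_spectral, Matrix.mul_sub, Matrix.trace_sub, hlog, htrA, htrB]
  simp only [trace_spectral_mul_spectral, ← Finset.sum_sub_distrib, ← Finset.sum_add_distrib]
  refine Finset.sum_congr rfl fun i _ => Finset.sum_congr rfl fun j _ => ?_
  rw [InformationTheory.klFun_apply, Real.log_div (ha i).ne' (hb j).ne']
  have := (hb j).ne'
  simp only [Pi.mul_apply, Pi.one_apply, Function.comp_apply]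
  field_simp
  ring

lemma relEntropy_nonneg {A B : Matrix ι ι ℝ} (hA : A.PosDef) (hB : B.PosDef) :
    0 ≤ relEntropy A B := by
  obtain ⟨V, a, rfl⟩ := exists_eq_spectral hA.isHermitian
  obtain ⟨W, b, rfl⟩ := exists_eq_spectral hB.isHermitian
  rw [posDef_spectral_iff] at hA hB
  rw [relEntropy_spectral V W hA hB]
  exact Finset.sum_nonneg fun i _ => Finset.sum_nonneg fun j _ => mul_nonneg (sq_nonneg _) <|
    mul_nonneg (hB j).le (InformationTheory.klFun_nonneg (div_pos (hA i) (hB j)).le)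

lemma interpolation_pos {x y u : ℝ} (hx : 0 < x) (hy : 0 < y) (hu : u ∈ Set.Icc (0 : ℝ) 1) :
    0 < (1 - u) * x + u * y :=
  convex_Ioi (0 : ℝ) hx hy (sub_nonneg.2 hu.2) hu.1 (sub_add_cancel 1 u)

lemma intervalIntegrable_chiSq {x y : ℝ} (hx : 0 < x) (hy : 0 < y) :
    IntervalIntegrable (fun u => u * ((x - y) ^ 2 / ((1 - u) * x + u * y))) volume 0 1 := by
  refine ContinuousOn.intervalIntegrable ?_
  rw [Set.uIcc_of_le zero_le_one]
  exact continuousOn_id.mul <| continuousOn_const.div (by fun_prop) fun u hu =>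
    (interpolation_pos hx hy hu).ne'

lemma mul_klFun_div_eq_integral_chiSq {x y : ℝ} (hx : 0 < x) (hy : 0 < y) :
    y * klFun (x / y) = ∫ u in (0 : ℝ)..1, u * ((x - y) ^ 2 / ((1 - u) * x + u * y)) := by
  rw [intervalIntegral.integral_eq_sub_of_hasDerivAt
    (f := fun u => u * (y - x) - x * Real.log ((1 - u) * x + u * y)) ?_
    (intervalIntegrable_chiSq hx hy)]
  · rw [InformationTheory.klFun_apply, Real.log_div hx.ne' hy.ne']
    field_simp
    simp
    ring
  · intro u hu
    rw [Set.uIcc_of_le zero_le_one] at hu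
    have hpos := interpolation_pos hx hy hu
    have hsegment : HasDerivAt (fun u : ℝ => (1 - u) * x + u * y) (-1 * x + 1 * y) u :=
      (((hasDerivAt_id u).const_sub 1).mul_const x).add ((hasDerivAt_id u).mul_const y)
    refine (((hasDerivAt_id u).mul_const (y - x)).sub
      ((hsegment.log hpos.ne').const_mul x)).congr_deriv ?_
    rw [mul_div_assoc', mul_div_assoc', sub_eq_iff_eq_add, ← add_div, eq_div_iff hpos.ne']
    ring

variable (V W : Matrix.orthogonalGroup ι ℝ) {a b : ι → ℝ} {u : ℝ}

lemma chiSqFunctional_spectral (a b : ι → ℝ) (u : ℝ) (Y : Matrix ι ι ℝ) :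
    chiSqFunctional u (spectral V a) (spectral W b) (V.1 * Y * W.1ᵀ) =
      ∑ i, ∑ j, (2 * (a i - b j) * (V.1ᵀ * W.1) i j - ((1 - u) * a i + u * b j) * Y i j) *
        Y i j := by
  have hV : V.1ᵀ * V.1 = 1 := (Matrix.mem_orthogonalGroup_iff' ι ℝ).1 V.2
  have hW : W.1ᵀ * W.1 = 1 := (Matrix.mem_orthogonalGroup_iff' ι ℝ).1 W.2
  have hleft : spectral V a * (V.1 * Y * W.1ᵀ) = V.1 * (Matrix.diagonal a * Y) * W.1ᵀ := by
    calc _ = V.1 * Matrix.diagonal a * (V.1ᵀ * V.1) * Y * W.1ᵀ := by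
          simp only [spectral_apply, Matrix.mul_assoc]
      _ = _ := by simp only [hV, mul_one, Matrix.mul_assoc]
  have hright : V.1 * Y * W.1ᵀ * spectral W b = V.1 * (Y * Matrix.diagonal b) * W.1ᵀ := by
    calc _ = V.1 * Y * (W.1ᵀ * W.1) * Matrix.diagonal b * W.1ᵀ := by
          simp only [spectral_apply, Matrix.mul_assoc]
      _ = _ := by simp only [hW, mul_one, Matrix.mul_assoc]
  have hfactor : (2 : ℝ) • (spectral V a - spectral W b) - ((1 - u) •
      (V.1 * (Matrix.diagonal a * Y) * W.1ᵀ) + u • (V.1 * (Y * Matrix.diagonal b) * W.1ᵀ)) =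
      V.1 * ((2 : ℝ) • (Matrix.diagonal a * (V.1ᵀ * W.1) - V.1ᵀ * W.1 * Matrix.diagonal b) -
        ((1 - u) • (Matrix.diagonal a * Y) + u • (Y * Matrix.diagonal b))) * W.1ᵀ := by
    rw [spectral_eq_conj_left V W a, spectral_eq_conj_right V W b]
    simp only [Matrix.mul_sub, Matrix.mul_add, Matrix.sub_mul, Matrix.add_mul, Matrix.mul_smul,
      Matrix.smul_mul]
  rw [chiSqFunctional, hleft, hright, hfactor, trace_conj_mul_conj_transpose]
  refine Finset.sum_congr rfl fun i _ => Finset.sum_congr rfl fun j _ => ?_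
  simp only [Matrix.sub_apply, Matrix.add_apply, Matrix.smul_apply, Matrix.diagonal_mul,
    Matrix.mul_diagonal, smul_eq_mul]
  ring

lemma isGreatest_chiSqFunctional_spectral (ha : ∀ i, 0 < a i) (hb : ∀ i, 0 < b i)
    (hu : u ∈ Set.Icc (0 : ℝ) 1) :
    IsGreatest (Set.range (chiSqFunctional u (spectral V a) (spectral W b)))
      (∑ i, ∑ j, (V.1ᵀ * W.1) i j ^ 2 * ((a i - b j) ^ 2 / ((1 - u) * a i + u * b j))) := by
  have hV : V.1 * V.1ᵀ = 1 := (Matrix.mem_orthogonalGroup_iff ι ℝ).1 V.2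
  have hW : W.1 * W.1ᵀ = 1 := (Matrix.mem_orthogonalGroup_iff ι ℝ).1 W.2
  constructor
  · refine ⟨V.1 * (Matrix.of fun i j =>
      (V.1ᵀ * W.1) i j * (a i - b j) / ((1 - u) * a i + u * b j)) * W.1ᵀ, ?_⟩
    rw [chiSqFunctional_spectral]
    refine Finset.sum_congr rfl fun i _ => Finset.sum_congr rfl fun j _ => ?_
    have := (interpolation_pos (ha i) (hb j) hu).ne'
    rw [Matrix.of_apply]
    generalize (1 - u) * a i + u * b j = d at this ⊢
    field_simp
    ring
  · rintro _ ⟨Z, rfl⟩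
    have hZ : Z = V.1 * (V.1ᵀ * Z * W.1) * W.1ᵀ := by
      simp only [← Matrix.mul_assoc, hV, one_mul]
      rw [Matrix.mul_assoc, hW, mul_one]
    rw [hZ, chiSqFunctional_spectral]
    refine Finset.sum_le_sum fun i _ => Finset.sum_le_sum fun j _ => ?_
    have hpos := interpolation_pos (ha i) (hb j) hu
    rw [← mul_div_assoc, le_div_iff₀ hpos]
    nlinarith [sq_nonneg ((V.1ᵀ * Z * W.1) i j * ((1 - u) * a i + u * b j) -
      (V.1ᵀ * W.1) i j * (a i - b j))]

lemma chiSqDiv_spectral (ha : ∀ i, 0 < a i) (hb : ∀ i, 0 < b i) (hu : u ∈ Set.Icc (0 : ℝ) 1) :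
    chiSqDiv u (spectral V a) (spectral W b) =
      ∑ i, ∑ j, (V.1ᵀ * W.1) i j ^ 2 * ((a i - b j) ^ 2 / ((1 - u) * a i + u * b j)) :=
  (isGreatest_chiSqFunctional_spectral V W ha hb hu).csSup_eq

lemma mul_chiSqDiv_spectral (ha : ∀ i, 0 < a i) (hb : ∀ i, 0 < b i) :
    Set.EqOn (fun u => u * chiSqDiv u (spectral V a) (spectral W b))
      (fun u => ∑ i, ∑ j, (V.1ᵀ * W.1) i j ^ 2 *
        (u * ((a i - b j) ^ 2 / ((1 - u) * a i + u * b j)))) (Set.uIcc 0 1) := by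
  intro u hu
  rw [Set.uIcc_of_le zero_le_one] at hu
  simp only [chiSqDiv_spectral V W ha hb hu, Finset.mul_sum, mul_left_comm u]

end Eigenbasis

variable {A B : Matrix ι ι ℝ} {u : ℝ}

lemma chiSqFunctional_le_chiSqDiv (hA : A.PosDef) (hB : B.PosDef) (hu : u ∈ Set.Icc (0 : ℝ) 1)
    (Z : Matrix ι ι ℝ) : chiSqFunctional u A B Z ≤ chiSqDiv u A B := by
  classical
  obtain ⟨V, a, rfl⟩ := exists_eq_spectral hA.isHermitian
  obtain ⟨W, b, rfl⟩ := exists_eq_spectral hB.isHermitian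
  exact le_ciSup (isGreatest_chiSqFunctional_spectral V W ((posDef_spectral_iff V).1 hA)
    ((posDef_spectral_iff W).1 hB) hu).bddAbove Z

lemma convexOn_chiSqDiv (hu : u ∈ Set.Icc (0 : ℝ) 1) :
    ConvexOn ℝ ({A : Matrix ι ι ℝ | A.PosDef} ×ˢ {B : Matrix ι ι ℝ | B.PosDef})
      fun P => chiSqDiv u P.1 P.2 := by
  refine ⟨convex_setOf_posDef.prod convex_setOf_posDef,
    fun P hP Q hQ s t hs ht _ => ciSup_le fun Z => ?_⟩
  simp only [Prod.fst_add, Prod.snd_add, Prod.smul_fst, Prod.smul_snd, chiSqFunctional_add_smul]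
  exact add_le_add
    (mul_le_mul_of_nonneg_left (chiSqFunctional_le_chiSqDiv hP.1 hP.2 hu Z) hs)
    (mul_le_mul_of_nonneg_left (chiSqFunctional_le_chiSqDiv hQ.1 hQ.2 hu Z) ht)

lemma intervalIntegrable_chiSqDiv (hA : A.PosDef) (hB : B.PosDef) :
    IntervalIntegrable (fun u => u * chiSqDiv u A B) volume 0 1 := by
  classical
  obtain ⟨V, a, rfl⟩ := exists_eq_spectral hA.isHermitian
  obtain ⟨W, b, rfl⟩ := exists_eq_spectral hB.isHermitian
  rw [posDef_spectral_iff] at hA hB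
  refine IntervalIntegrable.congr
    ((mul_chiSqDiv_spectral V W hA hB).symm.mono Set.uIoc_subset_uIcc) ?_
  simpa only [Finset.sum_fn] using IntervalIntegrable.sum Finset.univ fun i _ =>
    IntervalIntegrable.sum Finset.univ fun j _ =>
      (intervalIntegrable_chiSq (hA i) (hB j)).const_mul ((V.1ᵀ * W.1) i j ^ 2)

variable [DecidableEq ι]

lemma relEntropy_eq_integral_chiSqDiv (hA : A.PosDef) (hB : B.PosDef) :
    relEntropy A B = ∫ u in (0 : ℝ)..1, u * chiSqDiv u A B := by
  obtain ⟨V, a, rfl⟩ := exists_eq_spectral hA.isHermitian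
  obtain ⟨W, b, rfl⟩ := exists_eq_spectral hB.isHermitian
  rw [posDef_spectral_iff] at hA hB
  have hint (i j : ι) := (intervalIntegrable_chiSq (hA i) (hB j)).const_mul ((V.1ᵀ * W.1) i j ^ 2)
  rw [intervalIntegral.integral_congr (mul_chiSqDiv_spectral V W hA hB),
    relEntropy_spectral V W hA hB, intervalIntegral.integral_finsetSum fun i _ => by
      simpa only [Finset.sum_fn] using IntervalIntegrable.sum Finset.univ fun j _ => hint i j]
  refine Finset.sum_congr rfl fun i _ => ?_
  rw [intervalIntegral.integral_finsetSum fun j _ => hint i j]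
  refine Finset.sum_congr rfl fun j _ => ?_
  rw [intervalIntegral.integral_const_mul, mul_klFun_div_eq_integral_chiSq (hA i) (hB j)]

theorem convexOn_relEntropy :
    ConvexOn ℝ ({A : Matrix ι ι ℝ | A.PosDef} ×ˢ {B : Matrix ι ι ℝ | B.PosDef})
      fun P => relEntropy P.1 P.2 := by
  have hconvex : Convex ℝ ({A : Matrix ι ι ℝ | A.PosDef} ×ˢ {B : Matrix ι ι ℝ | B.PosDef}) :=
    convex_setOf_posDef.prod convex_setOf_posDef
  refine ⟨hconvex, fun P hP Q hQ s t hs ht hst => ?_⟩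
  have hR := hconvex hP hQ hs ht hst
  have hintP := (intervalIntegrable_chiSqDiv hP.1 hP.2).const_mul s
  have hintQ := (intervalIntegrable_chiSqDiv hQ.1 hQ.2).const_mul t
  beta_reduce
  rw [relEntropy_eq_integral_chiSqDiv hR.1 hR.2, relEntropy_eq_integral_chiSqDiv hP.1 hP.2,
    relEntropy_eq_integral_chiSqDiv hQ.1 hQ.2, smul_eq_mul, smul_eq_mul,
    ← intervalIntegral.integral_const_mul, ← intervalIntegral.integral_const_mul,
    ← intervalIntegral.integral_add hintP hintQ]
  refine intervalIntegral.integral_mono_on zero_le_one (intervalIntegrable_chiSqDiv hR.1 hR.2)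
    (hintP.add hintQ) fun u hu => ?_
  calc u * chiSqDiv u (s • P + t • Q).1 (s • P + t • Q).2
      ≤ u * (s • chiSqDiv u P.1 P.2 + t • chiSqDiv u Q.1 Q.2) :=
        mul_le_mul_of_nonneg_left ((convexOn_chiSqDiv hu).2 hP hQ hs ht hst) hu.1
    _ = s * (u * chiSqDiv u P.1 P.2) + t * (u * chiSqDiv u Q.1 Q.2) := by
        simp only [smul_eq_mul]
        ring

end RelativeEntropy

section Lieb

variable {ι : Type*} [Fintype ι] {A B H K X Y : Matrix ι ι ℝ}

lemma trace_mul_nonneg (hA : 0 ≤ A) (hB : 0 ≤ B) : 0 ≤ (A * B).trace := by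
  classical
  obtain ⟨V, a, rfl⟩ := exists_eq_spectral (Matrix.nonneg_iff_posSemidef.1 hA).isHermitian
  obtain ⟨W, b, rfl⟩ := exists_eq_spectral (Matrix.nonneg_iff_posSemidef.1 hB).isHermitian
  rw [← map_zero (spectral _), spectral_le_spectral_iff] at hA hB
  rw [trace_spectral_mul_spectral]
  exact Finset.sum_nonneg fun i _ => Finset.sum_nonneg fun j _ =>
    mul_nonneg (sq_nonneg _) (mul_nonneg (hA i) (hB j))

variable [DecidableEq ι]

lemma posDef_exp (hH : H.IsHermitian) : (NormedSpace.exp H).PosDef := by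
  obtain ⟨V, a, rfl⟩ := exists_eq_spectral hH
  rw [exp_spectral, posDef_spectral_iff]
  exact fun i => Real.exp_pos _

lemma cfc_log_exp (hH : H.IsHermitian) : cfc Real.log (NormedSpace.exp H) = H := by
  obtain ⟨V, a, rfl⟩ := exists_eq_spectral hH
  simp only [exp_spectral, cfc_spectral, Function.comp_def, Real.log_exp]

lemma isHermitian_cfc (f : ℝ → ℝ) (A : Matrix ι ι ℝ) : (cfc f A).IsHermitian :=
  cfc_predicate f A

lemma trace_exp_mono (hH : H.IsHermitian) (hK : K.IsHermitian) (hHK : H ≤ K) :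
    (NormedSpace.exp H).trace ≤ (NormedSpace.exp K).trace := by
  have hklein := relEntropy_nonneg (posDef_exp hH) (posDef_exp hK)
  have htrace := trace_mul_nonneg (posDef_exp hH).posSemidef.nonneg (sub_nonneg.2 hHK)
  rw [relEntropy, cfc_log_exp hH, cfc_log_exp hK, Matrix.mul_sub, Matrix.trace_sub] at hklein
  rw [Matrix.mul_sub, Matrix.trace_sub] at htrace
  linarith

lemma trace_mul_sub_relEntropy_add_trace (A B : Matrix ι ι ℝ) (hY : Y.IsHermitian) :
    (B * Y).trace - relEntropy B A + A.trace =
      (NormedSpace.exp (Y + cfc Real.log A)).trace -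
        relEntropy B (NormedSpace.exp (Y + cfc Real.log A)) := by
  rw [relEntropy, relEntropy, cfc_log_exp (hY.add (isHermitian_cfc _ A))]
  simp only [Matrix.mul_sub, Matrix.mul_add, Matrix.trace_sub, Matrix.trace_add]
  ring

/-- Lieb's concavity theorem. By the Gibbs variational principle `tr exp (Y + log A)` is the maximum
over `B` of the jointly concave function `tr (B Y) - relEntropy B A + tr A`. -/
theorem concaveOn_trace_exp_add_log (hY : Y.IsHermitian) :
    ConcaveOn ℝ {A : Matrix ι ι ℝ | A.PosDef}
      fun A => (NormedSpace.exp (Y + cfc Real.log A)).trace := by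
  refine ⟨convex_setOf_posDef, fun A hA A' hA' s t hs ht hst => ?_⟩
  have hexp (A : Matrix ι ι ℝ) : (NormedSpace.exp (Y + cfc Real.log A)).PosDef :=
    posDef_exp (hY.add (isHermitian_cfc _ A))
  have hmax (A : Matrix ι ι ℝ) : (NormedSpace.exp (Y + cfc Real.log A)).trace =
      (NormedSpace.exp (Y + cfc Real.log A) * Y).trace -
        relEntropy (NormedSpace.exp (Y + cfc Real.log A)) A + A.trace := by
    rw [trace_mul_sub_relEntropy_add_trace _ _ hY]
    simp [relEntropy]
  beta_reduce
  rw [hmax A, hmax A']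
  set B := NormedSpace.exp (Y + cfc Real.log A)
  set B' := NormedSpace.exp (Y + cfc Real.log A')
  have hconvex : relEntropy (s • B + t • B') (s • A + t • A') ≤
      s • relEntropy B A + t • relEntropy B' A' :=
    convexOn_relEntropy.2 (x := (B, A)) (y := (B', A')) ⟨hexp A, hA⟩ ⟨hexp A', hA'⟩ hs ht hst
  have hklein := relEntropy_nonneg (convex_setOf_posDef (hexp A) (hexp A') hs ht hst)
    (hexp (s • A + t • A'))
  have hgibbs := trace_mul_sub_relEntropy_add_trace (s • A + t • A') (s • B + t • B') hY
  simp only [Matrix.add_mul, Matrix.smul_mul, Matrix.trace_add, Matrix.trace_smul, smul_eq_mul]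
    at hconvex hgibbs ⊢
  linarith

lemma exp_mul_le_one_add_mul {R θ x : ℝ} (hR : 0 < R) (hx : 0 ≤ x) (hxR : x ≤ R) :
    Real.exp (θ * x) ≤ 1 + (Real.exp (θ * R) - 1) / R * x := by
  have hchord := convexOn_exp.2 (Set.mem_univ 0) (Set.mem_univ (θ * R))
    (sub_nonneg.2 ((div_le_one hR).2 hxR)) (div_nonneg hx hR.le) (by ring)
  have hpoint : (1 - x / R) • 0 + (x / R) • (θ * R) = θ * x := by
    simp only [smul_eq_mul]
    field_simp
    ring
  rw [hpoint, Real.exp_zero] at hchord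
  refine hchord.trans_eq ?_
  simp only [smul_eq_mul]
  ring

variable {R : ℝ} (θ : ℝ)

lemma posDef_one_add_smul (hR : 0 < R) (h0 : 0 ≤ X) (hX : X ≤ R • 1) :
    (1 + ((Real.exp (θ * R) - 1) / R) • X).PosDef := by
  obtain ⟨V, a, rfl⟩ := exists_eq_spectral (Matrix.nonneg_iff_posSemidef.1 h0).isHermitian
  rw [← map_zero (spectral V), spectral_le_spectral_iff] at h0
  rw [← map_one (spectral V), ← map_smul, spectral_le_spectral_iff] at hX
  rw [← map_one (spectral V), ← map_smul, ← map_add, posDef_spectral_iff]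
  intro i
  have hexp := exp_mul_le_one_add_mul (θ := θ) hR (h0 i) (by simpa using hX i)
  simpa using (Real.exp_pos _).trans_le hexp

lemma smul_le_log_one_add_smul (hR : 0 < R) (h0 : 0 ≤ X) (hX : X ≤ R • 1) :
    θ • X ≤ cfc Real.log (1 + ((Real.exp (θ * R) - 1) / R) • X) := by
  obtain ⟨V, a, rfl⟩ := exists_eq_spectral (Matrix.nonneg_iff_posSemidef.1 h0).isHermitian
  rw [← map_zero (spectral V), spectral_le_spectral_iff] at h0
  rw [← map_one (spectral V), ← map_smul, spectral_le_spectral_iff] at hX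
  rw [← map_one (spectral V), ← map_smul, ← map_smul, ← map_add, cfc_spectral,
    spectral_le_spectral_iff]
  intro i
  have hexp := exp_mul_le_one_add_mul (θ := θ) hR (h0 i) (by simpa using hX i)
  simpa using (Real.le_log_iff_exp_le ((Real.exp_pos _).trans_le hexp)).2 hexp

lemma log_le_sub_one (hA : A.PosDef) : cfc Real.log A ≤ A - 1 := by
  obtain ⟨V, a, rfl⟩ := exists_eq_spectral hA.isHermitian
  rw [posDef_spectral_iff] at hA
  rw [cfc_spectral, ← map_one (spectral V), ← map_sub, spectral_le_spectral_iff]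
  exact fun i => Real.log_le_sub_one_of_pos (hA i)

lemma sum_mul_trace_exp_add_smul_le {κ : Type*} [Fintype κ] {w : κ → ℝ} (hw : ∀ x, 0 ≤ w x)
    (hw_sum : ∑ x, w x = 1) (hY : Y.IsHermitian) {X : κ → Matrix ι ι ℝ} (hR : 0 < R)
    (h0 : ∀ x, 0 ≤ X x) (hX : ∀ x, X x ≤ R • 1) :
    ∑ x, w x * (NormedSpace.exp (Y + θ • X x)).trace ≤
      (NormedSpace.exp (Y + ((Real.exp (θ * R) - 1) / R) • ∑ x, w x • X x)).trace := by
  set c := (Real.exp (θ * R) - 1) / R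
  set A : κ → Matrix ι ι ℝ := fun x => 1 + c • X x
  have hA (x : κ) : (A x).PosDef := posDef_one_add_smul θ hR (h0 x) (hX x)
  have hmean : ∑ x, w x • A x = 1 + c • ∑ x, w x • X x := by
    simp only [A, smul_add, Finset.sum_add_distrib, ← Finset.sum_smul, hw_sum, one_smul,
      Finset.smul_sum, smul_comm c]
  have hmean_posDef : (1 + c • ∑ x, w x • X x).PosDef :=
    hmean ▸ convex_setOf_posDef.sum_mem (fun x _ => hw x) hw_sum fun x _ => hA x
  have hlog (A : Matrix ι ι ℝ) : (Y + cfc Real.log A).IsHermitian := hY.add (isHermitian_cfc _ A)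
  calc ∑ x, w x * (NormedSpace.exp (Y + θ • X x)).trace
      ≤ ∑ x, w x * (NormedSpace.exp (Y + cfc Real.log (A x))).trace := by
        gcongr with x
        · exact hw x
        · refine trace_exp_mono (hY.add ?_) (hlog _)
            (add_le_add_right (smul_le_log_one_add_smul θ hR (h0 x) (hX x)) Y)
          exact (Matrix.nonneg_iff_posSemidef.1 (h0 x)).isHermitian.smul (.all θ)
    _ ≤ (NormedSpace.exp (Y + cfc Real.log (∑ x, w x • A x))).trace :=
        (concaveOn_trace_exp_add_log hY).le_map_sum (fun x _ => hw x) hw_sum fun x _ => hA x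
    _ ≤ (NormedSpace.exp (Y + c • ∑ x, w x • X x)).trace := by
        rw [hmean]
        refine trace_exp_mono (hlog _) (hY.add ?_) (add_le_add_right ?_ Y)
        · simpa using hmean_posDef.isHermitian.sub Matrix.isHermitian_one
        · simpa using log_le_sub_one hmean_posDef

lemma exp_le_trace_exp (hH : H.IsHermitian) {t : ℝ} (ht : ¬ H ≤ t • 1) :
    Real.exp t ≤ (NormedSpace.exp H).trace := by
  obtain ⟨V, a, rfl⟩ := exists_eq_spectral hH
  rw [← map_one (spectral V), ← map_smul, spectral_le_spectral_iff, Pi.le_def] at ht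
  push Not at ht
  obtain ⟨i, hi⟩ := ht
  rw [exp_spectral, trace_spectral]
  refine le_trans (Real.exp_le_exp.2 ?_)
    (Finset.single_le_sum (fun j _ => (Real.exp_pos (a j)).le) (Finset.mem_univ i))
  simpa using hi.le

lemma trace_exp_le (hH : H.IsHermitian) {t : ℝ} (ht : H ≤ t • 1) :
    (NormedSpace.exp H).trace ≤ Fintype.card ι * Real.exp t := by
  refine (trace_exp_mono hH (Matrix.isHermitian_one.smul (.all t)) ht).trans_eq ?_
  rw [← map_one (spectral 1), ← map_smul, exp_spectral, trace_spectral]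
  simp

end Lieb

section Chernoff

lemma integral_eq_sum_mul_integral_of_indepFun {Ω κ E : Type*} [MeasurableSpace Ω] [Finite E]
    [MeasurableSpace E] [MeasurableSingletonClass E] [Fintype κ] [MeasurableSpace κ]
    [MeasurableSingletonClass κ] {μ : Measure Ω} [IsProbabilityMeasure μ] {X : Ω → κ} {Y : Ω → E}
    (hX : Measurable X) (hY : Measurable Y) (hXY : IndepFun X Y μ) (F : κ → E → ℝ) :
    ∫ w, F (X w) (Y w) ∂μ = ∑ x, μ.real (X ⁻¹' {x}) * ∫ w, F x (Y w) ∂μ := by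
  have := Measure.isProbabilityMeasure_map (μ := μ) hX.aemeasurable
  have := Measure.isProbabilityMeasure_map (μ := μ) hY.aemeasurable
  have hlaw := (indepFun_iff_map_prod_eq_prod_map_map hX.aemeasurable hY.aemeasurable).1 hXY
  calc ∫ w, F (X w) (Y w) ∂μ = ∫ z, F z.1 z.2 ∂(μ.map X).prod (μ.map Y) := by
        rw [← hlaw, integral_map (hX.prodMk hY).aemeasurable
          (measurable_of_countable _).aestronglyMeasurable]
    _ = ∫ x, ∫ y, F x y ∂μ.map Y ∂μ.map X := integral_prod _ .of_finite
    _ = ∑ x, μ.real (X ⁻¹' {x}) * ∫ w, F x (Y w) ∂μ := by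
        rw [integral_fintype .of_finite]
        refine Finset.sum_congr rfl fun x _ => ?_
        rw [map_measureReal_apply hX (measurableSet_singleton x), smul_eq_mul,
          integral_map hY.aemeasurable (measurable_of_countable _).aestronglyMeasurable]

variable {Ω ι κ η : Type*} [MeasurableSpace Ω] [MeasurableSpace κ] {μ : Measure Ω}
  {p : ι → κ → ℝ} {ω : ι → Ω → κ}

lemma IsIndependentDraw.prob_nonneg (hω : IsIndependentDraw μ p ω) (j : ι) (i : κ) : 0 ≤ p j i :=
  hω.law j i ▸ measureReal_nonneg

variable [Fintype κ] [MeasurableSingletonClass κ] [IsProbabilityMeasure μ]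

lemma IsIndependentDraw.sum_prob (hω : IsIndependentDraw μ p ω) (j : ι) : ∑ i, p j i = 1 := by
  simp only [← hω.law j]
  rw [sum_measureReal_preimage_singleton _ fun i _ => hω.measurable j (measurableSet_singleton i)]
  simp

lemma IsIndependentDraw.integral_insert (hω : IsIndependentDraw μ p ω) {j : ι} {s : Finset ι}
    (hj : j ∉ s) (F : κ → (s → κ) → ℝ) :
    ∫ w, F (ω j w) (fun l => ω l w) ∂μ = ∑ i, p j i * ∫ w, F i (fun l => ω l w) ∂μ := by
  have hindep : IndepFun (ω j) (fun w (l : s) => ω l w) μ :=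
    (hω.indep.indepFun_finset {j} s (Finset.disjoint_singleton_left.2 hj) hω.measurable).comp
      (measurable_pi_apply (⟨j, Finset.mem_singleton_self j⟩ : ({j} : Finset ι))) measurable_id
  rw [integral_eq_sum_mul_integral_of_indepFun (hω.measurable j)
    (measurable_pi_lambda _ fun l : s => hω.measurable l) hindep]
  simp only [hω.law]

variable [Fintype η] [DecidableEq η] {X : ι → κ → Matrix η η ℝ} {R : ℝ}

lemma IsIndependentDraw.integral_trace_exp_add_smul_sum_le (hω : IsIndependentDraw μ p ω)
    (hR : 0 < R) (θ : ℝ) (h0 : ∀ j i, 0 ≤ X j i) (hX : ∀ j i, X j i ≤ R • 1) (s : Finset ι)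
    {Y : Matrix η η ℝ} (hY : Y.IsHermitian) :
    ∫ w, (NormedSpace.exp (Y + θ • ∑ j ∈ s, X j (ω j w))).trace ∂μ ≤
      (NormedSpace.exp (Y + ((Real.exp (θ * R) - 1) / R) •
        ∑ j ∈ s, ∑ i, p j i • X j i)).trace := by
  classical
  set c := (Real.exp (θ * R) - 1) / R
  have hXH (j : ι) (i : κ) : (X j i).IsHermitian :=
    (Matrix.nonneg_iff_posSemidef.1 (h0 j i)).isHermitian
  induction s using Finset.induction_on generalizing Y with
  | empty => simp
  | insert j s hj ih =>
    set E := ∑ j ∈ s, ∑ i, p j i • X j i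
    have hE : E.IsHermitian := isSelfAdjoint_sum _ fun j _ =>
      isSelfAdjoint_sum _ fun i _ => (hXH j i).smul (.all (p j i))
    have hsum (w : Ω) : ∑ l : s, X l (ω l w) = ∑ l ∈ s, X l (ω l w) :=
      Finset.sum_coe_sort s fun l => X l (ω l w)
    calc ∫ w, (NormedSpace.exp (Y + θ • ∑ l ∈ insert j s, X l (ω l w))).trace ∂μ
        = ∫ w, (NormedSpace.exp ((Y + θ • X j (ω j w)) + θ • ∑ l : s, X l (ω l w))).trace ∂μ := by
          simp only [Finset.sum_insert hj, smul_add, add_assoc, hsum]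
      _ = ∑ i, p j i * ∫ w, (NormedSpace.exp ((Y + θ • X j i) +
            θ • ∑ l ∈ s, X l (ω l w))).trace ∂μ := by
          rw [hω.integral_insert hj fun i y =>
            (NormedSpace.exp ((Y + θ • X j i) + θ • ∑ l : s, X l (y l))).trace]
          simp only [hsum]
      _ ≤ ∑ i, p j i * (NormedSpace.exp ((Y + c • E) + θ • X j i)).trace := by
          gcongr with i
          · exact hω.prob_nonneg j i
          · rw [add_right_comm]
            exact ih (hY.add ((hXH j i).smul (.all θ)))
      _ ≤ (NormedSpace.exp ((Y + c • E) + c • ∑ i, p j i • X j i)).trace :=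
          sum_mul_trace_exp_add_smul_le θ (hω.prob_nonneg j) (hω.sum_prob j)
            (hY.add (hE.smul (.all c))) hR (h0 j) (hX j)
      _ = _ := by
          rw [Finset.sum_insert hj, smul_add, add_assoc, add_comm (c • E)]

variable [Fintype ι]

lemma IsIndependentDraw.measureReal_not_smul_sum_le (hω : IsIndependentDraw μ p ω)
    (hR : 0 < R) (θ : ℝ) (h0 : ∀ j i, 0 ≤ X j i) (hX : ∀ j i, X j i ≤ R • 1) {a : ℝ}
    (hmean : ((Real.exp (θ * R) - 1) / R) • ∑ j, ∑ i, p j i • X j i ≤ a • 1) (t : ℝ) :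
    μ.real {w | ¬ θ • ∑ j, X j (ω j w) ≤ t • 1} ≤ Fintype.card η * Real.exp (a - t) := by
  have hXH (j : ι) (i : κ) : (X j i).IsHermitian :=
    (Matrix.nonneg_iff_posSemidef.1 (h0 j i)).isHermitian
  have hsum (w : Ω) : (θ • ∑ j, X j (ω j w)).IsHermitian :=
    IsSelfAdjoint.smul (.all θ) (isSelfAdjoint_sum _ fun j _ => hXH j (ω j w))
  have hmean_herm : (((Real.exp (θ * R) - 1) / R) • ∑ j, ∑ i, p j i • X j i).IsHermitian :=
    IsSelfAdjoint.smul (.all _) <| isSelfAdjoint_sum _ fun j _ =>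
      isSelfAdjoint_sum _ fun i _ => (hXH j i).smul (.all (p j i))
  have hint : Integrable (fun w => (NormedSpace.exp (θ • ∑ j, X j (ω j w))).trace) μ :=
    Integrable.comp_measurable (g := fun y : ι → κ => (NormedSpace.exp (θ • ∑ j, X j (y j))).trace)
      (f := fun w j => ω j w) .of_finite (measurable_pi_lambda _ hω.measurable)
  have hmarkov : Real.exp t * μ.real {w | ¬ θ • ∑ j, X j (ω j w) ≤ t • 1} ≤
      Fintype.card η * Real.exp a :=
    calc _ ≤ Real.exp t * μ.real {w | Real.exp t ≤
          (NormedSpace.exp (θ • ∑ j, X j (ω j w))).trace} :=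
          mul_le_mul_of_nonneg_left (measureReal_mono fun w hw => exp_le_trace_exp (hsum w) hw)
            (Real.exp_pos t).le
      _ ≤ ∫ w, (NormedSpace.exp (θ • ∑ j, X j (ω j w))).trace ∂μ :=
          mul_meas_ge_le_integral_of_nonneg
            (.of_forall fun w => (posDef_exp (hsum w)).posSemidef.trace_nonneg) hint _
      _ ≤ (NormedSpace.exp (((Real.exp (θ * R) - 1) / R) • ∑ j, ∑ i, p j i • X j i)).trace := by
          simpa only [zero_add] using hω.integral_trace_exp_add_smul_sum_le hR θ h0 hX Finset.univ
            Matrix.isHermitian_zero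
      _ ≤ Fintype.card η * Real.exp a := trace_exp_le hmean_herm hmean
  rw [Real.exp_sub, mul_div_assoc', le_div_iff₀' (Real.exp_pos t)]
  exact hmarkov

lemma sub_mul_log_one_add_le {δ : ℝ} (h0 : 0 ≤ δ) (h1 : δ ≤ 1) :
    δ - (1 + δ) * Real.log (1 + δ) ≤ -(δ ^ 2 / 3) := by
  have hlog := mul_le_mul_of_nonneg_left (Real.le_log_one_add_of_nonneg h0)
    (add_nonneg zero_le_one h0)
  have hrational : δ + δ ^ 2 / 3 ≤ (1 + δ) * (2 * δ / (δ + 2)) := by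
    rw [mul_div_assoc', le_div_iff₀ (by positivity)]
    nlinarith [mul_nonneg (sq_nonneg δ) (sub_nonneg.2 h1)]
  linarith

lemma neg_sub_mul_log_one_sub_le {δ : ℝ} (h0 : 0 ≤ δ) (h1 : δ < 1) :
    -δ - (1 - δ) * Real.log (1 - δ) ≤ -(δ ^ 2 / 3) := by
  have hderiv {x : ℝ} (hx : x < 1) :
      HasDerivAt (fun x : ℝ => -x - (1 - x) * Real.log (1 - x) + x ^ 2 / 2)
        (Real.log (1 - x) + x) x := by
    have hx' : (1 : ℝ) - x ≠ 0 := (sub_pos.2 hx).ne'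
    have hsub : HasDerivAt (fun x : ℝ => 1 - x) (-1) x := (hasDerivAt_id x).const_sub 1
    refine (((hasDerivAt_id x).neg.sub (hsub.mul (hsub.log hx'))).add
      (((hasDerivAt_id x).pow 2).div_const 2)).congr_deriv ?_
    simp
    field_simp
    ring
  have hanti : AntitoneOn (fun x : ℝ => -x - (1 - x) * Real.log (1 - x) + x ^ 2 / 2)
      (Set.Icc 0 δ) := by
    refine antitoneOn_of_hasDerivWithinAt_nonpos (convex_Icc 0 δ)
      (fun x hx => (hderiv (hx.2.trans_lt h1)).continuousAt.continuousWithinAt)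
      (fun x hx => (hderiv ((interior_subset hx).2.trans_lt h1)).hasDerivWithinAt) fun x hx => ?_
    have := Real.log_le_sub_one_of_pos (sub_pos.2 ((interior_subset hx).2.trans_lt h1))
    linarith
  have hzero := hanti (Set.left_mem_Icc.2 h0) (Set.right_mem_Icc.2 h0) h0
  simp only [neg_zero, sub_zero, Real.log_one, mul_zero, ne_eq, OfNat.ofNat_ne_zero,
    not_false_eq_true, zero_pow, zero_div, add_zero] at hzero
  nlinarith [sq_nonneg δ]

variable {δ b : ℝ}

theorem IsIndependentDraw.measureReal_not_sum_le (hω : IsIndependentDraw μ p ω) (hR : 0 < R)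
    (h0 : ∀ j i, 0 ≤ X j i) (hX : ∀ j i, X j i ≤ R • 1) (hδ : 0 < δ) (hδ1 : δ ≤ 1) (hb : 0 ≤ b)
    (hmean : ∑ j, ∑ i, p j i • X j i ≤ b • 1) :
    μ.real {w | ¬ ∑ j, X j (ω j w) ≤ ((1 + δ) * b) • 1} ≤
      Fintype.card η * Real.exp (-(δ ^ 2 * b / (3 * R))) := by
  set θ := Real.log (1 + δ) / R
  have hθ : 0 < θ := div_pos (Real.log_pos (by linarith)) hR
  have hc : (Real.exp (θ * R) - 1) / R = δ / R := by
    rw [div_mul_cancel₀ _ hR.ne', Real.exp_log (by positivity), add_sub_cancel_left]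
  have htail := hω.measureReal_not_smul_sum_le hR θ h0 hX (a := δ / R * b)
    (by rw [hc, mul_smul]; gcongr) (θ * ((1 + δ) * b))
  simp only [mul_smul θ, smul_le_smul_iff_of_pos_left hθ] at htail
  refine htail.trans (mul_le_mul_of_nonneg_left (Real.exp_le_exp.2 ?_) (Nat.cast_nonneg _))
  calc δ / R * b - θ * ((1 + δ) * b) = b / R * (δ - (1 + δ) * Real.log (1 + δ)) := by
        simp only [θ]
        ring
    _ ≤ b / R * -(δ ^ 2 / 3) := by
        gcongr
        exact sub_mul_log_one_add_le hδ.le hδ1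
    _ = -(δ ^ 2 * b / (3 * R)) := by field_simp

theorem IsIndependentDraw.measureReal_not_le_sum (hω : IsIndependentDraw μ p ω) (hR : 0 < R)
    (h0 : ∀ j i, 0 ≤ X j i) (hX : ∀ j i, X j i ≤ R • 1) (hδ : 0 < δ) (hδ1 : δ < 1) (hb : 0 ≤ b)
    (hmean : b • 1 ≤ ∑ j, ∑ i, p j i • X j i) :
    μ.real {w | ¬ ((1 - δ) * b) • 1 ≤ ∑ j, X j (ω j w)} ≤
      Fintype.card η * Real.exp (-(δ ^ 2 * b / (3 * R))) := by
  set θ := Real.log (1 - δ) / R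
  have hθ : θ < 0 := div_neg_of_neg_of_pos (Real.log_neg (by linarith) (by linarith)) hR
  have hc : (Real.exp (θ * R) - 1) / R = -(δ / R) := by
    rw [div_mul_cancel₀ _ hR.ne', Real.exp_log (by linarith), sub_sub_cancel_left, neg_div]
  have htail := hω.measureReal_not_smul_sum_le hR θ h0 hX (a := -(δ / R) * b)
    (by rw [hc, mul_smul, neg_smul, neg_smul, neg_le_neg_iff]; gcongr) (θ * ((1 - δ) * b))
  simp only [mul_smul θ, smul_le_smul_iff_of_neg_left hθ] at htail
  refine htail.trans (mul_le_mul_of_nonneg_left (Real.exp_le_exp.2 ?_) (Nat.cast_nonneg _))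
  calc -(δ / R) * b - θ * ((1 - δ) * b) = b / R * (-δ - (1 - δ) * Real.log (1 - δ)) := by
        simp only [θ]
        ring
    _ ≤ b / R * -(δ ^ 2 / 3) := by
        gcongr
        exact neg_sub_mul_log_one_sub_le hδ.le hδ1
    _ = -(δ ^ 2 * b / (3 * R)) := by field_simp

theorem IsIndependentDraw.one_sub_le_measureReal_sum_mem_Icc (hω : IsIndependentDraw μ p ω)
    (hR : 0 < R) (h0 : ∀ j i, 0 ≤ X j i) (hX : ∀ j i, X j i ≤ R • 1) (hδ : δ ∈ Set.Ioo 0 1)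
    (hmean : ∑ j, ∑ i, p j i • X j i = 1) :
    1 - 2 * Fintype.card η * Real.exp (-(δ ^ 2 / (3 * R))) ≤
      μ.real {w | ∑ j, X j (ω j w) ∈ Set.Icc ((1 - δ) • 1) ((1 + δ) • 1)} := by
  have hmean' : ∑ j, ∑ i, p j i • X j i = (1 : ℝ) • 1 := hmean.trans (one_smul ℝ _).symm
  have hlower := hω.measureReal_not_le_sum hR h0 hX hδ.1 hδ.2 zero_le_one hmean'.ge
  have hupper := hω.measureReal_not_sum_le hR h0 hX hδ.1 hδ.2.le zero_le_one hmean'.le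
  simp only [mul_one] at hlower hupper
  have hmeas : MeasurableSet {w | ∑ j, X j (ω j w) ∈ Set.Icc ((1 - δ) • 1) ((1 + δ) • 1)} :=
    measurable_pi_lambda (fun w j => ω j w) hω.measurable (Set.toFinite
      {y : ι → κ | ∑ j, X j (y j) ∈ Set.Icc ((1 - δ) • 1) ((1 + δ) • 1)}).measurableSet
  have hunion : μ.real {w | ∑ j, X j (ω j w) ∈ Set.Icc ((1 - δ) • 1) ((1 + δ) • 1)}ᶜ ≤
      μ.real {w | ¬ (1 - δ) • 1 ≤ ∑ j, X j (ω j w)} +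
        μ.real {w | ¬ ∑ j, X j (ω j w) ≤ (1 + δ) • 1} := by
    rw [show {w | ∑ j, X j (ω j w) ∈ Set.Icc ((1 - δ) • 1) ((1 + δ) • 1)}ᶜ =
      {w | ¬ (1 - δ) • 1 ≤ ∑ j, X j (ω j w)} ∪ {w | ¬ ∑ j, X j (ω j w) ≤ (1 + δ) • 1} by
        ext w
        exact not_and_or]
    exact measureReal_union_le _ _
  rw [probReal_compl_eq_one_sub hmeas] at hunion
  linarith

end Chernoff

section LeastSquares

section Minimizer

variable {F G : Type*} [AddCommGroup F] [Module ℝ F] [NormedAddCommGroup G] {E : Submodule ℝ F}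

lemma norm_map_sub_le_of_isMinOn [Module ℝ G] {Φ : F →ₗ[ℝ] G} {e : G} {x x' : F} (hx : x ∈ E)
    (hmin : IsMinOn (fun z => ‖Φ z - (Φ x + e)‖) E x') : ‖Φ (x' - x)‖ ≤ 2 * ‖e‖ := by
  have hfit : ‖Φ x' - (Φ x + e)‖ ≤ ‖e‖ := by
    simpa only [sub_add_cancel_left, norm_neg] using isMinOn_iff.1 hmin x hx
  calc ‖Φ (x' - x)‖ = ‖(Φ x' - (Φ x + e)) + e‖ := by
        rw [map_sub]
        congr 1
        abel
    _ ≤ ‖Φ x' - (Φ x + e)‖ + ‖e‖ := norm_add_le _ _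
    _ ≤ 2 * ‖e‖ := by linarith

variable [InnerProductSpace ℝ G]

lemma isMinOn_norm_sub_iff {K : Submodule ℝ G} [K.HasOrthogonalProjection] {u v : G}
    (hv : v ∈ K) : IsMinOn (fun z => ‖z - u‖) K v ↔ v = K.starProjection u := by
  have hiInf : IsMinOn (fun z => ‖z - u‖) K v ↔ ‖u - v‖ = ⨅ w : (K : Set G), ‖u - w‖ := by
    have hbdd : BddBelow (Set.range fun w : (K : Set G) => ‖u - w‖) :=
      ⟨0, Set.forall_mem_range.2 fun _ => norm_nonneg _⟩
    refine ⟨fun h => le_antisymm (le_ciInf fun w => ?_) (ciInf_le hbdd ⟨v, hv⟩),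
      fun h => isMinOn_iff.2 fun w hw => ?_⟩
    · simpa only [norm_sub_rev] using isMinOn_iff.1 h w w.2
    · simpa only [norm_sub_rev u] using h.trans_le (ciInf_le hbdd ⟨w, hw⟩)
  rw [hiInf, K.norm_eq_iInf_iff_real_inner_eq_zero hv]
  refine ⟨fun h => (K.eq_starProjection_of_mem_of_inner_eq_zero hv h).symm, ?_⟩
  rintro rfl w hw
  exact K.starProjection_inner_eq_zero u w hw

lemma existsUnique_isMinOn_norm_map_sub {Φ : F →ₗ[ℝ] G} [(E.map Φ).HasOrthogonalProjection]
    (hΦ : Set.InjOn Φ E) (u : G) : ∃! x, x ∈ E ∧ IsMinOn (fun z => ‖Φ z - u‖) E x := by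
  have hmin {x : F} (hx : x ∈ E) :
      IsMinOn (fun z => ‖Φ z - u‖) E x ↔ Φ x = (E.map Φ).starProjection u := by
    rw [← isMinOn_norm_sub_iff (Submodule.mem_map_of_mem hx)]
    simp [isMinOn_iff]
  obtain ⟨x, hx, hxu⟩ := (E.map Φ).starProjection_apply_mem u
  refine ⟨x, ⟨hx, (hmin hx).2 hxu⟩, fun y hy => hΦ hy.1 hx ?_⟩
  rw [hxu, (hmin hy.1).1 hy.2]

lemma eq_of_isMinOn_norm_map_sub_map {Φ : F →ₗ[ℝ] G} (hΦ : Set.InjOn Φ E) {x x' : F} (hx : x ∈ E)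
    (hx' : x' ∈ E) (hmin : IsMinOn (fun z => ‖Φ z - Φ x‖) E x') : x' = x :=
  hΦ hx' hx <| sub_eq_zero.1 <| norm_le_zero_iff.1 <| by simpa using isMinOn_iff.1 hmin x hx

end Minimizer

lemma l2norm_sq {ι : Type*} [Fintype ι] (v : ι → ℝ) : l2norm v ^ 2 = v ⬝ᵥ v := by
  rw [l2norm, EuclideanSpace.norm_sq_eq]
  simp [dotProduct, sq]

lemma l2norm_nonneg {ι : Type*} [Fintype ι] (v : ι → ℝ) : 0 ≤ l2norm v := norm_nonneg _

variable {n T : ℕ} {M : Type*} [Fintype M] [DecidableEq M] {E : Submodule ℝ (Fin n → ℝ)}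
  {A : Matrix (Fin n) (Fin n) ℝ} {S : Matrix M (Fin T × Fin n) ℝ} {P W : Matrix M M ℝ}

/-- The linear map `x ↦ P^{-1/2} W^{1/2} S π_{A,T}(x)` fitted to the data by the least-squares
problem, with values in the Euclidean space. -/
noncomputable def measurement (A : Matrix (Fin n) (Fin n) ℝ) (S : Matrix M (Fin T × Fin n) ℝ)
    (P W : Matrix M M ℝ) : (Fin n → ℝ) →ₗ[ℝ] EuclideanSpace ℝ M :=
  (WithLp.linearEquiv 2 ℝ (M → ℝ)).symm.toLinearMap ∘ₗ
    (Matrix.diagonal (fun r => (√(P r r))⁻¹) * Matrix.diagonal fun r => √(W r r)).mulVecLin ∘ₗ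
    S.mulVecLin ∘ₗ LinearMap.pi fun q => LinearMap.proj q.2 ∘ₗ (A ^ (q.1 : ℕ)).mulVecLin

lemma measurement_apply (z : Fin n → ℝ) :
    measurement A S P W z = WithLp.toLp 2 (reweight P W (S *ᵥ diffusionField A T z)) := rfl

lemma isLeastSquares_iff {y : M → ℝ} {x : Fin n → ℝ} :
    IsLeastSquares E A S P W y x ↔ x ∈ E ∧
      IsMinOn (fun z => ‖measurement A S P W z - WithLp.toLp 2 (reweight P W y)‖) E x := by
  simp only [IsLeastSquares, isMinOn_iff, l2norm, reweight, Matrix.mulVec_sub, WithLp.toLp_sub,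
    measurement_apply, SetLike.mem_coe]

lemma toLp_reweight_add (z : Fin n → ℝ) (e : M → ℝ) :
    WithLp.toLp 2 (reweight P W (S *ᵥ diffusionField A T z + e)) =
      measurement A S P W z + WithLp.toLp 2 (reweight P W e) := by
  rw [reweight, Matrix.mulVec_add, WithLp.toLp_add]
  rfl

lemma injOn_measurement_of_le {α : ℝ} (hα : 0 < α)
    (hlow : ∀ z ∈ E, α * l2norm z ≤ ‖measurement A S P W z‖) :
    Set.InjOn (measurement A S P W) E := by
  intro x hx y hy hxy
  have hle := hlow _ (E.sub_mem hx hy)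
  rw [map_sub, hxy, sub_self, norm_zero] at hle
  have hzero : l2norm (x - y) = 0 :=
    le_antisymm (nonpos_of_mul_nonpos_right hle hα) (l2norm_nonneg _)
  rw [l2norm, norm_eq_zero, WithLp.toLp_eq_zero] at hzero
  exact sub_eq_zero.1 hzero

lemma existsUnique_isLeastSquares (hinj : Set.InjOn (measurement A S P W) E) (y : M → ℝ) :
    ∃! x, IsLeastSquares E A S P W y x := by
  simp only [isLeastSquares_iff]
  exact existsUnique_isMinOn_norm_map_sub hinj _

lemma IsLeastSquares.l2norm_sub_le {α : ℝ} (hα : 0 < α)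
    (hlow : ∀ z ∈ E, α * l2norm z ≤ ‖measurement A S P W z‖) {x x' : Fin n → ℝ} {e : M → ℝ}
    (hx : x ∈ E) (hx' : IsLeastSquares E A S P W (S *ᵥ diffusionField A T x + e) x') :
    l2norm (x' - x) ≤ 2 / α * l2norm (reweight P W e) := by
  rw [isLeastSquares_iff, toLp_reweight_add] at hx'
  rw [div_mul_eq_mul_div, le_div_iff₀' hα]
  exact (hlow _ (E.sub_mem hx'.1 hx)).trans (norm_map_sub_le_of_isMinOn hx hx'.2)

lemma IsLeastSquares.eq_add (hinj : Set.InjOn (measurement A S P W) E) {x x₀ x' : Fin n → ℝ}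
    (hx : x ∈ E) (hx₀ : x₀ ∈ E)
    (hx' : IsLeastSquares E A S P W (S *ᵥ diffusionField A T x + S *ᵥ diffusionField A T x₀) x') :
    x' = x + x₀ := by
  rw [isLeastSquares_iff, toLp_reweight_add, ← measurement_apply, ← map_add] at hx'
  exact eq_of_isMinOn_norm_map_sub_map hinj (E.add_mem hx hx₀) hx'.1 hx'.2

/-- The measurements of a signal `x₀` are noise that no least-squares method can detect: the
solution is `x + x₀`. -/
lemma errorBounds_of_stable {α β : ℝ} (hα : 0 < α) (hβ : 0 < β) (hE : E ≠ ⊥)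
    (hlow : ∀ z ∈ E, α * l2norm z ≤ ‖measurement A S P W z‖)
    (hup : ∀ z ∈ E, ‖measurement A S P W z‖ ≤ β * l2norm z) :
    ErrorBounds E A S P W (2 / α) (1 / β) := by
  have hinj := injOn_measurement_of_le hα hlow
  obtain ⟨x₀, hx₀, hne⟩ := E.exists_mem_ne_zero_of_ne_bot hE
  refine fun x hx => ⟨fun e => ⟨existsUnique_isLeastSquares hinj _, fun x' hx' =>
    hx'.l2norm_sub_le hα hlow hx⟩, S *ᵥ diffusionField A T x₀, fun h0 => hne ?_, fun x' hx' => ?_⟩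
  · refine hinj hx₀ E.zero_mem ?_
    rw [measurement_apply, h0, reweight, Matrix.mulVec_zero, WithLp.toLp_zero, map_zero]
  · rw [hx'.eq_add hinj hx hx₀, add_sub_cancel_left, one_div, inv_mul_le_iff₀ hβ]
    exact hup x₀ hx₀

end LeastSquares

section Sampling

variable {M N η : Type*}

/-- The restricted isometry property of the sampling of the rows `loc r` of `V`, where `q` holds
the probabilities of the rows and `wt` the weights of the samples: on the range of a `V` with
orthonormal columns, the reweighted sampling preserves the squared norm up to a factor
`1 ± δ`. -/
def IsRestrictedIsometry [Fintype M] [Fintype η] (δ : ℝ) (V : Matrix N η ℝ) (loc : M → N)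
    (q : N → ℝ) (wt : M → ℝ) : Prop :=
  ∀ b : η → ℝ, ∑ r, wt r / q (loc r) * (V *ᵥ b) (loc r) ^ 2 ∈
    Set.Icc ((1 - δ) * (b ⬝ᵥ b)) ((1 + δ) * (b ⬝ᵥ b))

/-- The Gram matrix `v vᵀ` of the row `v` of `V` with index `x`. -/
def rowGram (V : Matrix N η ℝ) (x : N) : Matrix η η ℝ := Matrix.vecMulVec (V x) (V x)

lemma sum_rowGram [Fintype N] (V : Matrix N η ℝ) : ∑ x, rowGram V x = Vᵀ * V := by
  ext i j
  simp [rowGram, Matrix.sum_apply, Matrix.vecMulVec_apply, Matrix.mul_apply]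

lemma rowGram_nonneg [Finite η] (V : Matrix N η ℝ) (x : N) : 0 ≤ rowGram V x :=
  (Matrix.posSemidef_vecMulVec_self_star (V x)).nonneg

lemma one_div_smul_le_of_sampleSize [Finite η] [DecidableEq η] {B : Matrix η η ℝ} {c : ℝ}
    {m : ℕ} {ν δ L : ℝ} (hδ : 0 < δ) (hL : 0 < L) (hc : 0 ≤ c) (hm : 3 / δ ^ 2 * ν ^ 2 * L ≤ m)
    (hB : B ≤ (c * ν ^ 2) • 1) :
    (1 / (m : ℝ)) • B ≤ (c * (δ ^ 2 / (3 * L))) • 1 := by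
  have := Fintype.ofFinite η
  have hν : ν ^ 2 / m ≤ δ ^ 2 / (3 * L) := by
    refine div_le_of_le_mul₀ (Nat.cast_nonneg m) (by positivity) ?_
    calc ν ^ 2 = δ ^ 2 / (3 * L) * (3 / δ ^ 2 * ν ^ 2 * L) := by field_simp
      _ ≤ δ ^ 2 / (3 * L) * m := by gcongr
  calc (1 / (m : ℝ)) • B ≤ (1 / (m : ℝ)) • (c * ν ^ 2) • (1 : Matrix η η ℝ) := by gcongr
    _ = (c * (ν ^ 2 / m)) • 1 := by
        rw [smul_smul]
        ring_nf
    _ ≤ (c * (δ ^ 2 / (3 * L))) • 1 := by gcongr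

lemma sum_one_div_smul_of_sampleSize {κ : Type*} [Fintype κ] [DecidableEq η]
    {B : κ → Matrix η η ℝ} {c : κ → ℝ} {m : ℕ} {ν δ L : ℝ} (hδ : 0 < δ) (hL : 0 < L)
    (hm : 3 / δ ^ 2 * ν ^ 2 * L ≤ m) (h0 : ∀ i, 0 ≤ B i) (hB : ∀ i, B i ≤ (c i * ν ^ 2) • 1) :
    ∑ _ : Fin m, (1 / (m : ℝ)) • ∑ i, B i = ∑ i, B i := by
  rw [Finset.sum_const, Finset.card_univ, Fintype.card_fin, ← Nat.cast_smul_eq_nsmul ℝ, smul_smul]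
  rcases eq_or_ne m 0 with rfl | hm0
  · have hν : ν ^ 2 = 0 := by
      refine le_antisymm ?_ (sq_nonneg ν)
      rw [mul_right_comm, Nat.cast_zero] at hm
      exact nonpos_of_mul_nonpos_right hm (by positivity)
    have hzero (i : κ) : B i = 0 := le_antisymm (by simpa [hν] using hB i) (h0 i)
    simp [hzero]
  · rw [mul_one_div_cancel (Nat.cast_ne_zero.2 hm0), one_smul]

variable [Fintype η]

lemma le_iff_dotProduct_mulVec_le {A B : Matrix η η ℝ} (hA : A.IsHermitian) (hB : B.IsHermitian) :
    A ≤ B ↔ ∀ z, z ⬝ᵥ (A *ᵥ z) ≤ z ⬝ᵥ (B *ᵥ z) := by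
  rw [Matrix.le_iff, Matrix.posSemidef_iff_dotProduct_mulVec, and_iff_right (hB.sub hA)]
  simp [Matrix.sub_mulVec, dotProduct_sub]

lemma dotProduct_rowGram_mulVec (V : Matrix N η ℝ) (x : N) (z : η → ℝ) :
    z ⬝ᵥ (rowGram V x *ᵥ z) = (V *ᵥ z) x ^ 2 := by
  rw [rowGram, Matrix.vecMulVec_mulVec, dotProduct_smul, op_smul_eq_mul, dotProduct_comm z, sq]
  rfl

variable [DecidableEq η]

lemma isRestrictedIsometry_of_mem_Icc [Fintype M] {δ : ℝ} {V : Matrix N η ℝ} {loc : M → N}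
    {q : N → ℝ} {wt : M → ℝ}
    (h : ∑ r, (wt r / q (loc r)) • rowGram V (loc r) ∈ Set.Icc ((1 - δ) • 1) ((1 + δ) • 1)) :
    IsRestrictedIsometry δ V loc q wt := by
  intro b
  have hone (c : ℝ) : (c • (1 : Matrix η η ℝ)).IsHermitian := Matrix.isHermitian_one.smul (.all c)
  have hsum : (∑ r, (wt r / q (loc r)) • rowGram V (loc r)).IsHermitian :=
    isSelfAdjoint_sum _ fun r _ =>
      IsSelfAdjoint.smul (.all _) (rowGram_nonneg V (loc r)).isSelfAdjoint
  have hlower := (le_iff_dotProduct_mulVec_le (hone _) hsum).1 h.1 b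
  have hupper := (le_iff_dotProduct_mulVec_le hsum (hone _)).1 h.2 b
  simp only [Matrix.smul_mulVec, Matrix.one_mulVec, Matrix.sum_mulVec, dotProduct_smul,
    dotProduct_sum, dotProduct_rowGram_mulVec, smul_eq_mul] at hlower hupper
  exact ⟨hlower, hupper⟩

lemma log_two_mul_div_pos {k : ℕ} (hk : 1 ≤ k) {ε : ℝ} (hε : ε ∈ Set.Ioo 0 1) :
    0 < Real.log (2 * k / ε) := by
  have hk' : (1 : ℝ) ≤ k := Nat.one_le_cast.2 hk
  exact Real.log_pos ((one_lt_div hε.1).2 (by linarith [hε.2]))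

/-- Each draw samples one block of rows, the rows `node r i` with `draw r = j`; the blocks are the
independent summands of the matrix Chernoff inequality. -/
theorem IsIndependentDraw.one_sub_le_measureReal_isRestrictedIsometry {Ω ι κ : Type*}
    [MeasurableSpace Ω] [Finite ι] [DecidableEq ι] [Fintype κ] [MeasurableSpace κ]
    [MeasurableSingletonClass κ] [Fintype M] [Nonempty η] {μ : Measure Ω} [IsProbabilityMeasure μ]
    {p : ι → κ → ℝ} {ω : ι → Ω → κ} (hω : IsIndependentDraw μ p ω) (hp : ∀ j i, 0 < p j i)
    {V : Matrix N η ℝ} {draw : M → ι} {node : M → κ → N} {q : N → ℝ} {wt : M → ℝ}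
    (hq : ∀ r i, q (node r i) = p (draw r) i) (hwt : ∀ r, 0 ≤ wt r) {ε δ : ℝ}
    (hε : ε ∈ Set.Ioo 0 1) (hδ : δ ∈ Set.Ioo 0 1)
    (hbound : ∀ j i, ∑ r with draw r = j, wt r • rowGram V (node r i) ≤
      (p j i * (δ ^ 2 / (3 * Real.log (2 * Fintype.card η / ε)))) • 1)
    (hone : ∑ r, wt r • ∑ i, rowGram V (node r i) = 1) :
    1 - ε ≤ μ.real {w | IsRestrictedIsometry δ V (fun r => node r (ω (draw r) w)) q wt} := by
  have := Fintype.ofFinite ι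
  set L := Real.log (2 * Fintype.card η / ε)
  have hcard : 0 < Fintype.card η := Fintype.card_pos
  have hL0 : 0 < L := log_two_mul_div_pos hcard hε
  have hδ0 : 0 < δ := hδ.1
  let X (j : ι) (i : κ) : Matrix η η ℝ :=
    (p j i)⁻¹ • ∑ r with draw r = j, wt r • rowGram V (node r i)
  have hX0 (j : ι) (i : κ) : 0 ≤ X j i :=
    smul_nonneg (inv_nonneg.2 (hp j i).le) <|
      Finset.sum_nonneg fun r _ => smul_nonneg (hwt r) (rowGram_nonneg V (node r i))
  have hXR (j : ι) (i : κ) : X j i ≤ (δ ^ 2 / (3 * L)) • 1 :=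
    (inv_smul_le_iff_of_pos (hp j i)).2 <| by simpa only [mul_smul] using hbound j i
  have hmean : ∑ j, ∑ i, p j i • X j i = 1 := by
    simp only [X, smul_inv_smul₀ (hp _ _).ne']
    rw [Finset.sum_comm, ← hone]
    simp only [Finset.sum_fiberwise, Finset.smul_sum]
    exact Finset.sum_comm
  have hsum (w : Ω) : ∑ j, X j (ω j w) = ∑ r, (wt r / q (node r (ω (draw r) w))) •
      rowGram V (node r (ω (draw r) w)) := by
    rw [← Finset.sum_fiberwise _ draw]
    refine Finset.sum_congr rfl fun j _ => ?_
    simp only [X, Finset.smul_sum]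
    refine Finset.sum_congr rfl fun r hr => ?_
    obtain rfl := (Finset.mem_filter.1 hr).2
    rw [smul_smul, hq, inv_mul_eq_div]
  have hexp : 2 * Fintype.card η * Real.exp (-(δ ^ 2 / (3 * (δ ^ 2 / (3 * L))))) = ε := by
    have : δ ^ 2 / (3 * (δ ^ 2 / (3 * L))) = L := by field_simp
    rw [this, Real.exp_neg, Real.exp_log (div_pos (by positivity) hε.1), inv_div,
      mul_div_cancel₀ _ (by positivity)]
  rw [← hexp]
  refine (hω.one_sub_le_measureReal_sum_mem_Icc (by positivity) hX0 hXR hδ hmean).trans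
    (measureReal_mono fun w hw => isRestrictedIsometry_of_mem_Icc ?_)
  rw [← hsum]
  exact hw

open scoped Matrix.Norms.L2Operator in
lemma opNorm_nonneg [Fintype N] (B : Matrix N η ℝ) : 0 ≤ opNorm B := norm_nonneg B

lemma transpose_mul_self_le_opNorm_sq [Fintype N] (B : Matrix N η ℝ) :
    Bᵀ * B ≤ (opNorm B ^ 2) • 1 := by
  refine (le_iff_dotProduct_mulVec_le (Matrix.isHermitian_conjTranspose_mul_self B)
    (Matrix.isHermitian_one.smul (.all (opNorm B ^ 2)))).2 fun z => ?_
  calc z ⬝ᵥ ((Bᵀ * B) *ᵥ z) = l2norm (B *ᵥ z) ^ 2 := by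
        rw [l2norm_sq, ← Matrix.mulVec_mulVec, Matrix.mulVec_transpose, dotProduct_comm,
          Matrix.dotProduct_mulVec]
    _ ≤ (opNorm B * l2norm z) ^ 2 := by
        gcongr
        · exact l2norm_nonneg _
        · exact Matrix.l2_opNorm_mulVec B (WithLp.toLp 2 z)
    _ = z ⬝ᵥ (((opNorm B ^ 2) • (1 : Matrix η η ℝ)) *ᵥ z) := by
        rw [mul_pow, l2norm_sq, Matrix.smul_mulVec, Matrix.one_mulVec, dotProduct_smul, smul_eq_mul]

lemma rowGram_le_l2norm_sq [DecidableEq N] [Fintype N] (V : Matrix N η ℝ) (x : N) :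
    rowGram V x ≤ (l2norm (Vᵀ *ᵥ Pi.single x 1) ^ 2) • 1 := by
  refine (le_iff_dotProduct_mulVec_le (rowGram_nonneg V x).isSelfAdjoint
    (Matrix.isHermitian_one.smul (.all _))).2 fun z => ?_
  rw [dotProduct_rowGram_mulVec, Matrix.smul_mulVec, Matrix.one_mulVec, dotProduct_smul, l2norm_sq,
    Matrix.mulVec_single_one, smul_eq_mul]
  simpa only [Matrix.mulVec, Matrix.col_apply, Matrix.transpose_apply, dotProduct, sq]
    using Finset.sum_mul_sq_le_sq_mul_sq Finset.univ (V x) z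

lemma sq_le_mul_iSup_sq {κ : Type*} [Finite κ] {p ρ : κ → ℝ} (hp : ∀ i, 0 < p i)
    (hρ : ∀ i, 0 ≤ ρ i) (i : κ) : ρ i ^ 2 ≤ p i * (⨆ j, 1 / √(p j) * ρ j) ^ 2 := by
  have hle : 1 / √(p i) * ρ i ≤ ⨆ j, 1 / √(p j) * ρ j :=
    le_ciSup (f := fun j => 1 / √(p j) * ρ j) (Set.finite_range _).bddAbove i
  rw [one_div, inv_mul_le_iff₀ (Real.sqrt_pos.2 (hp i))] at hle
  calc ρ i ^ 2 ≤ (√(p i) * ⨆ j, 1 / √(p j) * ρ j) ^ 2 := pow_le_pow_left₀ (hρ i) hle 2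
    _ = p i * (⨆ j, 1 / √(p j) * ρ j) ^ 2 := by rw [mul_pow, Real.sq_sqrt (hp i).le]

variable {n k T : ℕ} (V : Matrix (Fin T × Fin n) (Fin k) ℝ)

lemma sum_rowGram_le_coherence₁ {p : Fin n → ℝ} (hp : ∀ i, 0 < p i) (i : Fin n) :
    ∑ t, rowGram V (t, i) ≤ (p i * coherence₁ V p ^ 2) • 1 :=
  calc ∑ t, rowGram V (t, i) = (V.submatrix (fun t : Fin T => (t, i)) id)ᵀ *
        V.submatrix (fun t : Fin T => (t, i)) id :=
        sum_rowGram (V.submatrix (fun t : Fin T => (t, i)) id)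
    _ ≤ _ := transpose_mul_self_le_opNorm_sq _
    _ ≤ _ := by
      gcongr
      exact sq_le_mul_iSup_sq (ρ := fun i => opNorm (V.submatrix (fun t : Fin T => (t, i)) id)) hp
        (fun _ => opNorm_nonneg _) i

lemma rowGram_le_coherence₂ {p : Fin T → Fin n → ℝ} {t : Fin T} (hp : ∀ i, 0 < p t i)
    (i : Fin n) : rowGram V (t, i) ≤ (p t i * coherence₂ V p t ^ 2) • 1 := by
  refine (rowGram_le_l2norm_sq V (t, i)).trans ?_
  gcongr
  exact sq_le_mul_iSup_sq (ρ := fun i => l2norm (Vᵀ *ᵥ Pi.single (t, i) 1)) hp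
    (fun _ => l2norm_nonneg _) i

lemma rowGram_le_coherence₃ {p : Fin T × Fin n → ℝ} (hp : ∀ x, 0 < p x) (x : Fin T × Fin n) :
    rowGram V x ≤ (p x * coherence₃ V p ^ 2) • 1 := by
  refine (rowGram_le_l2norm_sq V x).trans ?_
  gcongr
  exact sq_le_mul_iSup_sq (ρ := fun x => l2norm (Vᵀ *ᵥ Pi.single x 1)) hp
    (fun _ => l2norm_nonneg _) x

end Sampling

section Regimes

variable {n k T : ℕ} [NeZero k] {V : Matrix (Fin T × Fin n) (Fin k) ℝ} {ε δ : ℝ} {Ω : Type*}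
  [MeasurableSpace Ω] {μ : Measure Ω} [IsProbabilityMeasure μ]

theorem one_sub_le_measureReal_isRestrictedIsometry₁ (hV : Vᵀ * V = 1) (hε : ε ∈ Set.Ioo 0 1)
    (hδ : δ ∈ Set.Ioo 0 1) {p : Fin n → ℝ} {m : ℕ} {ω : Fin m → Ω → Fin n} (hp : ∀ i, 0 < p i)
    (hω : IsIndependentDraw μ (fun _ => p) ω)
    (hm : 3 / δ ^ 2 * coherence₁ V p ^ 2 * Real.log (2 * k / ε) ≤ m) :
    1 - ε ≤ μ.real {w | IsRestrictedIsometry δ V (fun r : Fin T × Fin m => (r.1, ω r.2 w))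
      (fun x => p x.2) fun _ => 1 / (m : ℝ)} := by
  have hL := log_two_mul_div_pos (NeZero.one_le (n := k)) hε
  refine hω.one_sub_le_measureReal_isRestrictedIsometry (fun _ => hp) (draw := Prod.snd)
    (node := fun r i => (r.1, i)) (fun _ _ => rfl) (fun _ => by positivity) hε hδ
    (fun j i => ?_) ?_
  · simp only [Fintype.card_fin, Finset.sum_filter, Fintype.sum_prod_type, Finset.sum_ite_eq',
      Finset.mem_univ, if_true, ← Finset.smul_sum]
    exact one_div_smul_le_of_sampleSize hδ.1 hL (hp i).le hm (sum_rowGram_le_coherence₁ V hp i)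
  · rw [← hV, ← sum_rowGram, Fintype.sum_prod_type_right, Fintype.sum_prod_type_right,
      ← sum_one_div_smul_of_sampleSize hδ.1 hL hm
        (fun i => Finset.sum_nonneg fun t _ => rowGram_nonneg V (t, i))
        (sum_rowGram_le_coherence₁ V hp)]
    exact Finset.sum_congr rfl fun _ _ => by rw [← Finset.smul_sum, Finset.sum_comm]

theorem one_sub_le_measureReal_isRestrictedIsometry₂ (hV : Vᵀ * V = 1) (hε : ε ∈ Set.Ioo 0 1)
    (hδ : δ ∈ Set.Ioo 0 1) {p : Fin T → Fin n → ℝ} {m : Fin T → ℕ}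
    {ω : (Σ t, Fin (m t)) → Ω → Fin n} (hp : ∀ t i, 0 < p t i)
    (hω : IsIndependentDraw μ (fun r => p r.1) ω)
    (hm : ∀ t, 3 / δ ^ 2 * coherence₂ V p t ^ 2 * Real.log (2 * k / ε) ≤ m t) :
    1 - ε ≤ μ.real {w | IsRestrictedIsometry δ V (fun r : Σ t, Fin (m t) => (r.1, ω r w))
      (fun x => p x.1 x.2) fun r => 1 / (m r.1 : ℝ)} := by
  have hL := log_two_mul_div_pos (NeZero.one_le (n := k)) hε
  refine hω.one_sub_le_measureReal_isRestrictedIsometry (fun r => hp r.1) (draw := id)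
    (node := fun r i => (r.1, i)) (fun _ _ => rfl) (fun _ => by positivity) hε hδ
    (fun r i => ?_) ?_
  · simp only [Fintype.card_fin, id_eq, Finset.sum_filter, Finset.sum_ite_eq', Finset.mem_univ,
      if_true]
    exact one_div_smul_le_of_sampleSize hδ.1 hL (hp r.1 i).le (hm r.1)
      (rowGram_le_coherence₂ V (hp r.1) i)
  · rw [← hV, ← sum_rowGram, Fintype.sum_prod_type, Fintype.sum_sigma]
    exact Finset.sum_congr rfl fun t _ => sum_one_div_smul_of_sampleSize hδ.1 hL (hm t)
      (fun i => rowGram_nonneg V (t, i)) (rowGram_le_coherence₂ V (hp t))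

theorem one_sub_le_measureReal_isRestrictedIsometry₃ (hV : Vᵀ * V = 1) (hε : ε ∈ Set.Ioo 0 1)
    (hδ : δ ∈ Set.Ioo 0 1) {p : Fin T × Fin n → ℝ} {m : ℕ} {ω : Fin m → Ω → Fin T × Fin n}
    (hp : ∀ x, 0 < p x) (hω : IsIndependentDraw μ (fun _ => p) ω)
    (hm : 3 / δ ^ 2 * coherence₃ V p ^ 2 * Real.log (2 * k / ε) ≤ m) :
    1 - ε ≤ μ.real {w | IsRestrictedIsometry δ V (fun r => ω r w) p fun _ => 1 / (m : ℝ)} := by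
  have hL := log_two_mul_div_pos (NeZero.one_le (n := k)) hε
  refine hω.one_sub_le_measureReal_isRestrictedIsometry (fun _ => hp) (draw := id)
    (node := fun _ x => x) (fun _ _ => rfl) (fun _ => by positivity) hε hδ
    (fun r x => ?_) ?_
  · simp only [Fintype.card_fin, id_eq, Finset.sum_filter, Finset.sum_ite_eq', Finset.mem_univ,
      if_true]
    exact one_div_smul_le_of_sampleSize hδ.1 hL (hp x).le hm (rowGram_le_coherence₃ V hp x)
  · rw [sum_one_div_smul_of_sampleSize hδ.1 hL hm (rowGram_nonneg V) (rowGram_le_coherence₃ V hp),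
      sum_rowGram, hV]

end Regimes

section SpaceTime

section SampledMeasurement

variable {M N : Type*} [DecidableEq N] [Fintype N]

lemma sampledProb_apply [DecidableEq M] (loc : M → N) (q : N → ℝ) (r : M) :
    sampledProb (samplingMatrix loc) q r r = q (loc r) := by
  simp [sampledProb, samplingMatrix, Matrix.mul_apply, Matrix.diagonal_apply]

lemma samplingMatrix_mulVec (loc : M → N) (v : N → ℝ) : samplingMatrix loc *ᵥ v = v ∘ loc := by
  funext r
  simp [samplingMatrix, Matrix.mulVec, dotProduct]

lemma norm_measurement_sq {n T : ℕ} [Fintype M] [DecidableEq M] (A : Matrix (Fin n) (Fin n) ℝ)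
    (loc : M → Fin T × Fin n) {q : Fin T × Fin n → ℝ} (hq : ∀ x, 0 ≤ q x) {wt : M → ℝ}
    (hwt : ∀ r, 0 ≤ wt r) (z : Fin n → ℝ) :
    ‖measurement A (samplingMatrix loc) (sampledProb (samplingMatrix loc) q)
      (Matrix.diagonal wt) z‖ ^ 2 =
      ∑ r, wt r / q (loc r) * diffusionField A T z (loc r) ^ 2 := by
  rw [measurement_apply, ← l2norm, l2norm_sq, dotProduct]
  refine Finset.sum_congr rfl fun r _ => ?_
  rw [reweight, ← Matrix.mulVec_mulVec, Matrix.mulVec_diagonal, Matrix.mulVec_diagonal,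
    samplingMatrix_mulVec, sampledProb_apply, Matrix.diagonal_apply_eq, Function.comp_apply,
    ← sq, mul_pow, mul_pow, inv_pow, Real.sq_sqrt (hq _), Real.sq_sqrt (hwt r)]
  ring

end SampledMeasurement

lemma fT_sq (T : ℕ) (l : ℝ) : fT T l ^ 2 = ∑ t ∈ Finset.range T, l ^ (2 * t) :=
  Real.sq_sqrt (Finset.sum_nonneg fun t _ => (even_two_mul t).pow_nonneg l)

lemma fT_pos {T : ℕ} (hT : 1 ≤ T) (l : ℝ) : 0 < fT T l :=
  Real.sqrt_pos.2 <| Finset.sum_pos' (fun t _ => (even_two_mul t).pow_nonneg l)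
    ⟨0, Finset.mem_range.2 hT, by simp⟩

lemma fT_le_fT {T : ℕ} {l l' : ℝ} (h0 : 0 ≤ l) (h : l ≤ l') : fT T l ≤ fT T l' :=
  Real.sqrt_le_sqrt (Finset.sum_le_sum fun _ _ => pow_le_pow_left₀ h0 h _)

lemma antitone_fT_evolEigenvalue {n : ℕ} (T : ℕ) {Δt : ℝ} (hΔt : 0 ≤ Δt) {σ : Fin n → ℝ}
    (hσ : Monotone σ) : Antitone fun i => fT T (evolEigenvalue Δt σ i) := fun _ _ hij =>
  fT_le_fT (Real.exp_pos _).le <|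
    Real.exp_le_exp.2 (mul_le_mul_of_nonpos_left (hσ hij) (neg_nonpos.2 hΔt))

variable {n k T : ℕ} {hkn : k ≤ n} {Δt : ℝ} {L U : Matrix (Fin n) (Fin n) ℝ} {σ : Fin n → ℝ}

lemma firstCols_transpose_mul_firstCols (hU : U ∈ Matrix.orthogonalGroup (Fin n) ℝ) :
    (firstCols hkn U)ᵀ * firstCols hkn U = 1 :=
  calc (firstCols hkn U)ᵀ * firstCols hkn U =
        (Uᵀ * U).submatrix (Fin.castLE hkn) (Fin.castLE hkn) := rfl
    _ = 1 := by
        rw [show Uᵀ * U = 1 from (Matrix.mem_orthogonalGroup_iff' _ ℝ).1 hU,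
          Matrix.submatrix_one _ (Fin.castLE_injective hkn)]

lemma l2norm_firstCols_mulVec (hU : U ∈ Matrix.orthogonalGroup (Fin n) ℝ) (a : Fin k → ℝ) :
    l2norm (firstCols hkn U *ᵥ a) = l2norm a := by
  refine (sq_eq_sq₀ (l2norm_nonneg _) (l2norm_nonneg _)).1 ?_
  rw [l2norm_sq, l2norm_sq, Matrix.dotProduct_mulVec, ← Matrix.mulVec_transpose,
    Matrix.mulVec_mulVec, firstCols_transpose_mul_firstCols hU, Matrix.one_mulVec]

lemma mem_bandlimited {z : Fin n → ℝ} :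
    z ∈ bandlimited hkn U ↔ ∃ a, firstCols hkn U *ᵥ a = z := by
  rw [bandlimited, ← Matrix.range_mulVecLin, LinearMap.mem_range]
  rfl

lemma bandlimited_ne_bot [NeZero k] (hU : U ∈ Matrix.orthogonalGroup (Fin n) ℝ) :
    bandlimited hkn U ≠ ⊥ := by
  intro hbot
  have hzero : firstCols hkn U *ᵥ Pi.single 0 1 = 0 :=
    (Submodule.eq_bot_iff _).1 hbot _ (mem_bandlimited.2 ⟨_, rfl⟩)
  have hnorm := congrArg (· ^ 2) (l2norm_firstCols_mulVec (hkn := hkn) hU (Pi.single 0 1))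
  simp [hzero, l2norm_sq] at hnorm

lemma spectral_mul_firstCols (hU : U ∈ Matrix.orthogonalGroup (Fin n) ℝ) (b : Fin n → ℝ) :
    spectral ⟨U, hU⟩ b * firstCols hkn U =
      firstCols hkn U * Matrix.diagonal (b ∘ Fin.castLE hkn) := by
  have hmul : spectral ⟨U, hU⟩ b * U = U * Matrix.diagonal b := by
    rw [spectral_apply, Matrix.mul_assoc,
      show Uᵀ * U = 1 from (Matrix.mem_orthogonalGroup_iff' _ ℝ).1 hU, Matrix.mul_one]
  calc spectral ⟨U, hU⟩ b * firstCols hkn U =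
        (spectral ⟨U, hU⟩ b * U).submatrix id (Fin.castLE hkn) := rfl
    _ = firstCols hkn U * Matrix.diagonal (b ∘ Fin.castLE hkn) := by
        ext i l
        rw [hmul, Matrix.submatrix_apply, Matrix.mul_diagonal, Matrix.mul_diagonal]
        rfl

lemma IsEigenDecomposition.exp_neg_smul (hU : IsEigenDecomposition L U σ) (Δt : ℝ) :
    NormedSpace.exp (-Δt • L) = spectral ⟨U, hU.orthogonal⟩ (evolEigenvalue Δt σ) := by
  have hL : -Δt • L = spectral ⟨U, hU.orthogonal⟩ (-Δt • σ) := by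
    rw [map_smul]
    exact congrArg (-Δt • ·) hU.decomp
  rw [hL, exp_spectral]
  rfl

lemma IsEigenDecomposition.diffusionField_firstCols (hU : IsEigenDecomposition L U σ)
    (hT : 1 ≤ T) (a : Fin k → ℝ) :
    diffusionField (NormedSpace.exp (-Δt • L)) T (firstCols hkn U *ᵥ a) =
      spaceTimeBasis hkn T Δt U σ *ᵥ
        ((fun l => fT T (evolEigenvalue Δt σ (Fin.castLE hkn l))) * a) := by
  funext ⟨t, i⟩
  rw [diffusionField, hU.exp_neg_smul, ← map_pow, Matrix.mulVec_mulVec, spectral_mul_firstCols,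
    ← Matrix.mulVec_mulVec, Matrix.mulVec_apply_eq_sum, Matrix.mulVec_apply_eq_sum]
  refine Finset.sum_congr rfl fun l _ => ?_
  have hf := (fT_pos hT (evolEigenvalue Δt σ (Fin.castLE hkn l))).ne'
  simp only [spaceTimeBasis, Matrix.of_apply, Matrix.mulVec_diagonal, Function.comp_apply,
    Pi.pow_apply, Pi.mul_apply]
  field_simp

lemma spaceTimeBasis_transpose_mul_spaceTimeBasis (hT : 1 ≤ T)
    (hU : U ∈ Matrix.orthogonalGroup (Fin n) ℝ) :
    (spaceTimeBasis hkn T Δt U σ)ᵀ * spaceTimeBasis hkn T Δt U σ = 1 := by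
  let e (l : Fin k) : ℝ := evolEigenvalue Δt σ (Fin.castLE hkn l)
  have hfactor (l l' : Fin k) :
      ((spaceTimeBasis hkn T Δt U σ)ᵀ * spaceTimeBasis hkn T Δt U σ) l l' =
        (∑ t : Fin T, e l ^ (t : ℕ) / fT T (e l) * (e l' ^ (t : ℕ) / fT T (e l'))) *
          ((firstCols hkn U)ᵀ * firstCols hkn U) l l' := by
    rw [Matrix.mul_apply, Matrix.mul_apply, Finset.sum_mul_sum, Fintype.sum_prod_type]
    exact Finset.sum_congr rfl fun t _ => Finset.sum_congr rfl fun i _ => mul_mul_mul_comm _ _ _ _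
  ext l l'
  rw [hfactor, firstCols_transpose_mul_firstCols hU, Matrix.one_apply, mul_ite, mul_one, mul_zero]
  refine if_ctx_congr Iff.rfl (fun h => ?_) fun _ => rfl
  subst h
  calc ∑ t : Fin T, e l ^ (t : ℕ) / fT T (e l) * (e l ^ (t : ℕ) / fT T (e l)) =
        ∑ t : Fin T, e l ^ (2 * (t : ℕ)) / fT T (e l) ^ 2 :=
      Finset.sum_congr rfl fun t _ => by rw [← sq, div_pow, ← pow_mul, mul_comm]
    _ = 1 := by
      rw [← Finset.sum_div, Fin.sum_univ_eq_sum_range (fun t => e l ^ (2 * t)), ← fT_sq,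
        div_self (pow_pos (fT_pos hT _) 2).ne']

end SpaceTime

section ErrorBounds

lemma sq_mul_dotProduct_self_le {ι : Type*} [Fintype ι] {c : ℝ} {g : ι → ℝ} (hc : 0 ≤ c)
    (hg : ∀ i, c ≤ g i) (a : ι → ℝ) : c ^ 2 * (a ⬝ᵥ a) ≤ (g * a) ⬝ᵥ (g * a) := by
  rw [dotProduct, dotProduct, Finset.mul_sum]
  refine Finset.sum_le_sum fun i _ => ?_
  rw [Pi.mul_apply, ← sq, ← sq, mul_pow]
  gcongr
  exact hg i

lemma dotProduct_self_le_sq_mul {ι : Type*} [Fintype ι] {c : ℝ} {g : ι → ℝ} (hg0 : ∀ i, 0 ≤ g i)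
    (hg : ∀ i, g i ≤ c) (a : ι → ℝ) : (g * a) ⬝ᵥ (g * a) ≤ c ^ 2 * (a ⬝ᵥ a) := by
  rw [dotProduct, dotProduct, Finset.mul_sum]
  refine Finset.sum_le_sum fun i _ => ?_
  rw [Pi.mul_apply, ← sq, ← sq, mul_pow]
  gcongr
  exacts [hg0 i, hg i]

variable {n k T : ℕ} {hkn : k ≤ n} {Δt δ : ℝ} {L U : Matrix (Fin n) (Fin n) ℝ} {σ : Fin n → ℝ}
  {M : Type*} [Fintype M] [DecidableEq M] {loc : M → Fin T × Fin n} {q : Fin T × Fin n → ℝ}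
  {wt : M → ℝ}

lemma IsEigenDecomposition.norm_measurement_firstCols_sq (hU : IsEigenDecomposition L U σ)
    (hT : 1 ≤ T) (hq : ∀ x, 0 ≤ q x) (hwt : ∀ r, 0 ≤ wt r) (a : Fin k → ℝ) :
    ‖measurement (NormedSpace.exp (-Δt • L)) (samplingMatrix loc)
      (sampledProb (samplingMatrix loc) q) (Matrix.diagonal wt) (firstCols hkn U *ᵥ a)‖ ^ 2 =
      ∑ r, wt r / q (loc r) * (spaceTimeBasis hkn T Δt U σ *ᵥ
        ((fun l => fT T (evolEigenvalue Δt σ (Fin.castLE hkn l))) * a)) (loc r) ^ 2 := by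
  rw [norm_measurement_sq _ _ hq hwt, hU.diffusionField_firstCols hT]

lemma IsRestrictedIsometry.mul_l2norm_le_norm_measurement
    (hV : IsRestrictedIsometry δ (spaceTimeBasis hkn T Δt U σ) loc q wt)
    (hU : IsEigenDecomposition L U σ) (hT : 1 ≤ T) (hδ : δ ≤ 1) (hq : ∀ x, 0 ≤ q x)
    (hwt : ∀ r, 0 ≤ wt r) {c : ℝ} (hc : 0 ≤ c)
    (hcf : ∀ l, c ≤ fT T (evolEigenvalue Δt σ (Fin.castLE hkn l))) {z : Fin n → ℝ}
    (hz : z ∈ bandlimited hkn U) :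
    √(1 - δ) * c * l2norm z ≤ ‖measurement (NormedSpace.exp (-Δt • L)) (samplingMatrix loc)
      (sampledProb (samplingMatrix loc) q) (Matrix.diagonal wt) z‖ := by
  obtain ⟨a, rfl⟩ := mem_bandlimited.1 hz
  rw [l2norm_firstCols_mulVec hU.orthogonal]
  refine le_of_sq_le_sq ?_ (norm_nonneg _)
  rw [hU.norm_measurement_firstCols_sq hT hq hwt, mul_pow, mul_pow, l2norm_sq,
    Real.sq_sqrt (sub_nonneg.2 hδ), mul_assoc]
  exact (mul_le_mul_of_nonneg_left (sq_mul_dotProduct_self_le hc hcf a) (sub_nonneg.2 hδ)).trans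
    (hV _).1

lemma IsRestrictedIsometry.norm_measurement_le_mul_l2norm
    (hV : IsRestrictedIsometry δ (spaceTimeBasis hkn T Δt U σ) loc q wt)
    (hU : IsEigenDecomposition L U σ) (hT : 1 ≤ T) (hδ : 0 ≤ 1 + δ) (hq : ∀ x, 0 ≤ q x)
    (hwt : ∀ r, 0 ≤ wt r) {c : ℝ} (hc : 0 ≤ c)
    (hcf : ∀ l, fT T (evolEigenvalue Δt σ (Fin.castLE hkn l)) ≤ c) {z : Fin n → ℝ}
    (hz : z ∈ bandlimited hkn U) :
    ‖measurement (NormedSpace.exp (-Δt • L)) (samplingMatrix loc)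
      (sampledProb (samplingMatrix loc) q) (Matrix.diagonal wt) z‖ ≤ √(1 + δ) * c * l2norm z := by
  obtain ⟨a, rfl⟩ := mem_bandlimited.1 hz
  rw [l2norm_firstCols_mulVec hU.orthogonal]
  refine le_of_sq_le_sq ?_ (mul_nonneg (by positivity) (l2norm_nonneg _))
  rw [hU.norm_measurement_firstCols_sq hT hq hwt, mul_pow, mul_pow, l2norm_sq,
    Real.sq_sqrt hδ, mul_assoc]
  exact (hV _).2.trans
    (mul_le_mul_of_nonneg_left (dotProduct_self_le_sq_mul (fun _ => (fT_pos hT _).le) hcf a) hδ)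

theorem IsRestrictedIsometry.errorBounds [NeZero k]
    (hV : IsRestrictedIsometry δ (spaceTimeBasis hkn T Δt U σ) loc q wt)
    (hU : IsEigenDecomposition L U σ) (hT : 1 ≤ T) (hΔt : 0 ≤ Δt) (hδ : δ ∈ Set.Ioo 0 1)
    (hq : ∀ x, 0 ≤ q x) (hwt : ∀ r, 0 ≤ wt r) :
    ErrorBounds (bandlimited hkn U) (NormedSpace.exp (-Δt • L)) (samplingMatrix loc)
      (sampledProb (samplingMatrix loc) q) (Matrix.diagonal wt)
      (2 / (√(1 - δ) * fT T (evolEigenvalue Δt σ (Fin.castLE hkn ⊤))))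
      (1 / (√(1 + δ) * fT T (evolEigenvalue Δt σ (Fin.castLE hkn 0)))) := by
  have hf (i : Fin n) : 0 < fT T (evolEigenvalue Δt σ i) := fT_pos hT _
  have hanti := antitone_fT_evolEigenvalue T hΔt hU.monotone
  refine errorBounds_of_stable (mul_pos (Real.sqrt_pos.2 (sub_pos.2 hδ.2)) (hf _))
    (mul_pos (Real.sqrt_pos.2 (by linarith [hδ.1])) (hf _)) (bandlimited_ne_bot hU.orthogonal)
    (fun z hz => hV.mul_l2norm_le_norm_measurement hU hT hδ.2.le hq hwt (hf _).le
      (fun l => hanti ((Fin.castLE_le_castLE_iff hkn).2 le_top)) hz)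
    (fun z hz => hV.norm_measurement_le_mul_l2norm hU hT (by linarith [hδ.1]) hq hwt (hf _).le
      (fun l => hanti ((Fin.castLE_le_castLE_iff hkn).2 (Fin.zero_le l))) hz)

end ErrorBounds

end DynSampling

open DynSampling in
theorem mainTheorem2_general {n k T : ℕ} [NeZero k] (hkn : k ≤ n) (hT : 1 ≤ T)
    {L U : Matrix (Fin n) (Fin n) ℝ} {σ : Fin n → ℝ} (hU : IsEigenDecomposition L U σ)
    {Δt : ℝ} (hΔt : 0 ≤ Δt) {ε δ : ℝ} (hε : ε ∈ Set.Ioo (0 : ℝ) 1) (hδ : δ ∈ Set.Ioo (0 : ℝ) 1)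
    {Ω : Type*} [MeasurableSpace Ω] (μ : Measure Ω) [IsProbabilityMeasure μ] :
    (∀ (p : Fin n → ℝ) (m : ℕ) (ω : Fin m → Ω → Fin n),
      IsPosDistribution p → IsIndependentDraw μ (fun _ => p) ω →
      3 / δ ^ 2 * coherence₁ (spaceTimeBasis hkn T Δt U σ) p ^ 2 * Real.log (2 * k / ε) ≤ m →
      1 - ε ≤ μ.real {w | ErrorBounds (bandlimited hkn U) (NormedSpace.exp (-Δt • L))
        (samplingMatrix₁ T fun i => ω i w)
        (sampledProb (samplingMatrix₁ T fun i => ω i w) fun q => p q.2)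
        (weighting₁ T m)
        (2 / (√(1 - δ) * fT T (evolEigenvalue Δt σ (Fin.castLE hkn ⊤))))
        (1 / (√(1 + δ) * fT T (evolEigenvalue Δt σ (Fin.castLE hkn 0))))}) ∧
    (∀ (p : Fin T → Fin n → ℝ) (m : Fin T → ℕ) (ω : (Σ t, Fin (m t)) → Ω → Fin n),
      (∀ t, IsPosDistribution (p t)) → IsIndependentDraw μ (fun r => p r.1) ω →
      (∀ t, 3 / δ ^ 2 * coherence₂ (spaceTimeBasis hkn T Δt U σ) p t ^ 2 *
        Real.log (2 * k / ε) ≤ m t) →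
      1 - ε ≤ μ.real {w | ErrorBounds (bandlimited hkn U) (NormedSpace.exp (-Δt • L))
        (samplingMatrix₂ fun r => ω r w)
        (sampledProb (samplingMatrix₂ fun r => ω r w) fun q => p q.1 q.2)
        (weighting₂ m)
        (2 / (√(1 - δ) * fT T (evolEigenvalue Δt σ (Fin.castLE hkn ⊤))))
        (1 / (√(1 + δ) * fT T (evolEigenvalue Δt σ (Fin.castLE hkn 0))))}) ∧
    (∀ (p : Fin T × Fin n → ℝ) (m : ℕ) (ω : Fin m → Ω → Fin T × Fin n),
      IsPosDistribution p → IsIndependentDraw μ (fun _ => p) ω →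
      3 / δ ^ 2 * coherence₃ (spaceTimeBasis hkn T Δt U σ) p ^ 2 * Real.log (2 * k / ε) ≤ m →
      1 - ε ≤ μ.real {w | ErrorBounds (bandlimited hkn U) (NormedSpace.exp (-Δt • L))
        (samplingMatrix₃ fun i => ω i w)
        (sampledProb (samplingMatrix₃ fun i => ω i w) p)
        (weighting₃ m)
        (2 / (√(1 - δ) * fT T (evolEigenvalue Δt σ (Fin.castLE hkn ⊤))))
        (1 / (√(1 + δ) * fT T (evolEigenvalue Δt σ (Fin.castLE hkn 0))))}) := by
  have hV := spaceTimeBasis_transpose_mul_spaceTimeBasis (hkn := hkn) (Δt := Δt) (σ := σ) hT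
    hU.orthogonal
  refine ⟨fun p m ω hp hω hm => ?_, fun p m ω hp hω hm => ?_, fun p m ω hp hω hm => ?_⟩
  · exact (one_sub_le_measureReal_isRestrictedIsometry₁ hV hε hδ hp.pos hω hm).trans <|
      measureReal_mono fun w hw => IsRestrictedIsometry.errorBounds hw hU hT hΔt hδ
        (fun x => (hp.pos x.2).le) fun _ => by positivity
  · exact (one_sub_le_measureReal_isRestrictedIsometry₂ hV hε hδ (fun t => (hp t).pos) hω
      hm).trans <| measureReal_mono fun w hw => IsRestrictedIsometry.errorBounds hw hU hT hΔt hδ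
        (fun x => ((hp x.1).pos x.2).le) fun _ => by positivity
  · exact (one_sub_le_measureReal_isRestrictedIsometry₃ hV hε hδ hp.pos hω hm).trans <|
      measureReal_mono fun w hw => IsRestrictedIsometry.errorBounds hw hU hT hΔt hδ
        (fun x => (hp.pos x).le) fun _ => by positivity

theorem mainTheorem2 {n k T : ℕ} (hk : 1 ≤ k) (hkn : k ≤ n) (hT : 1 ≤ T)
    (G : DynSampling.WeightedGraph n) (hdeg : ∀ i, 0 < G.deg i)
    (Δt : ℝ) (hΔt : 0 < Δt)
    (U : Matrix (Fin n) (Fin n) ℝ) (σ : Fin n → ℝ)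
    (hU : DynSampling.IsEigenDecomposition G.laplacian U σ)
    (ε δ : ℝ) (hε : ε ∈ Set.Ioo (0 : ℝ) 1) (hδ : δ ∈ Set.Ioo (0 : ℝ) 1)
    {Ω : Type*} [MeasurableSpace Ω] (μ : Measure Ω) [IsProbabilityMeasure μ] :
    -- random spatial locations at the initial time
    (∀ (p : Fin n → ℝ) (m : ℕ) (ω : Fin m → Ω → Fin n),
      DynSampling.IsPosDistribution p →
      DynSampling.IsIndependentDraw μ (fun _ => p) ω →
      3 / δ ^ 2 * DynSampling.coherence₁ (DynSampling.spaceTimeBasis hkn T Δt U σ) p ^ 2 *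
        Real.log (2 * k / ε) ≤ m →
      1 - ε ≤ μ.real {w | DynSampling.ErrorBounds (DynSampling.bandlimited hkn U)
        (G.evolution Δt)
        (DynSampling.samplingMatrix₁ T fun i => ω i w)
        (DynSampling.sampledProb (DynSampling.samplingMatrix₁ T fun i => ω i w) fun q => p q.2)
        (DynSampling.weighting₁ T m)
        (2 / (√(1 - δ) *
          DynSampling.fT T (DynSampling.evolEigenvalue Δt σ ⟨k - 1, by omega⟩)))
        (1 / (√(1 + δ) *
          DynSampling.fT T (DynSampling.evolEigenvalue Δt σ ⟨0, by omega⟩)))}) ∧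
    -- random spatial locations at consecutive times
    (∀ (p : Fin T → Fin n → ℝ) (m : Fin T → ℕ) (ω : (Σ t, Fin (m t)) → Ω → Fin n),
      (∀ t, DynSampling.IsPosDistribution (p t)) →
      DynSampling.IsIndependentDraw μ (fun r => p r.1) ω →
      (∀ t, 3 / δ ^ 2 *
        DynSampling.coherence₂ (DynSampling.spaceTimeBasis hkn T Δt U σ) p t ^ 2 *
        Real.log (2 * k / ε) ≤ m t) →
      1 - ε ≤ μ.real {w | DynSampling.ErrorBounds (DynSampling.bandlimited hkn U)
        (G.evolution Δt)
        (DynSampling.samplingMatrix₂ fun r => ω r w)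
        (DynSampling.sampledProb (DynSampling.samplingMatrix₂ fun r => ω r w)
          fun q => p q.1 q.2)
        (DynSampling.weighting₂ m)
        (2 / (√(1 - δ) *
          DynSampling.fT T (DynSampling.evolEigenvalue Δt σ ⟨k - 1, by omega⟩)))
        (1 / (√(1 + δ) *
          DynSampling.fT T (DynSampling.evolEigenvalue Δt σ ⟨0, by omega⟩)))}) ∧
    -- random space-time locations
    (∀ (p : Fin T × Fin n → ℝ) (m : ℕ) (ω : Fin m → Ω → Fin T × Fin n),
      DynSampling.IsPosDistribution p →
      DynSampling.IsIndependentDraw μ (fun _ => p) ω →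
      3 / δ ^ 2 * DynSampling.coherence₃ (DynSampling.spaceTimeBasis hkn T Δt U σ) p ^ 2 *
        Real.log (2 * k / ε) ≤ m →
      1 - ε ≤ μ.real {w | DynSampling.ErrorBounds (DynSampling.bandlimited hkn U)
        (G.evolution Δt)
        (DynSampling.samplingMatrix₃ fun i => ω i w)
        (DynSampling.sampledProb (DynSampling.samplingMatrix₃ fun i => ω i w) p)
        (DynSampling.weighting₃ m)
        (2 / (√(1 - δ) *
          DynSampling.fT T (DynSampling.evolEigenvalue Δt σ ⟨k - 1, by omega⟩)))
        (1 / (√(1 + δ) *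
          DynSampling.fT T (DynSampling.evolEigenvalue Δt σ ⟨0, by omega⟩)))}) :=
  have : NeZero k := ⟨by omega⟩
  mainTheorem2_general hkn hT hU hΔt.le hε hδ μ
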